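/- Let $b\ge 1$ and $n\ge 1$ be integers. A $b$-ball juggling state is a sequence $\alpha=\langle\alpha_1,\alpha_2,\dots\rangle\in\{0,1\}^{\mathbb N}$ with $\sum_i\alpha_i=b$; there is an edge $\alpha\to\beta$ iff $\alpha_{i+1}\le\beta_i$ for all $i\ge1$. A prime $b$-ball pattern of period $n$ is a closed walk of length $n$ in this state graph with $n$ distinct states, taken up to rotation; $N'(b,n)$ is the number of these patterns. The card of an edge $\alpha\to\beta$ is $C_0$ if $\alpha_1=0$; if $\alpha_1=1$, the thrown ball is the unique index $k$ with $\beta_k=1$, $\alpha_{k+1}=0$, and the card is $C_m$ with $m=\#\{i\le k:\beta_i=1\}$. A filled Ferrers diagram is a filling of the cells of the Ferrers diagram of a partition $p_1>\dots>p_t\ge1$ of $n$ into distinct parts with integers from $\{0,\dots,b\}$ such that the rightmost cell of each row contains $b$, no other cell contains $b$, and each column contains at most one entry from $\{b,b-1\}$. A landing word $w=w_1\cdots w_n$ of the diagram is obtained by arranging its rows in some order, reading each row from right to left and concatenating; arrangements that differ by a rotation define the same cyclic order of the rows. The pattern generation algorithm assigns cards to the positions $1,\dots,n$ (taken modulo $n$)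 of a word $w$. First assign $C_0$ to every $j$ with $w_j=0$. Then for $v=1,\dots,b$ in turn, and for each $j$ with $w_j=v$ (in any order), start at $j$ with bump count $0$ and move left cyclically one position at a time; increase the bump count by $1$ whenever the position reached has no card yet or has a card $C_x$ with $x$ greater than the current bump count; at the position where the bump count reaches $v$, stop and assign $C_v$ to that position. Then: 1. For every landing word $w$ of every filled Ferrers diagram, every search of the algorithm terminates, and at the end every position carries a card with index at most $b$. The resulting card sequence does not depend on the order in which the positions with equal letters are treated, and it is the card sequence of exactly one closed walk of length $n$ in the $b$-ball state graph. This walk is prime. 2. The prime patterns obtained are distinct: the closed walks obtained from two diagrams, each with an arrangement of its rows, are rotations of each other if and only if the two diagrams are equal and the two arrangements define the same cyclic order of the rows. 3. If $b\ge2$, then $$N'(b,n)\ \ge\ \frac1b\sum_{t\ge1}\ \sum_{\substack{p_1>\cdots>p_t\ge1\\ p_1+\cdots+p_t=n}}\frac{(b-1)^n}{\binom{t+b-1}{b}}\prod_{i=1}^{t}\left(\frac{i+b-1}{i+b-2}\right)^{p_i}.$$ -/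

import Mathlib

namespace Juggling

/-! ### The state graph and prime patterns -/

/-- A juggling state `⟨α₁, α₂, …⟩` is recorded by the finite set of all `i : ℕ` with
`α_{i+1} = 1`; thus `i ∈ α` means that a ball lands `i` beats after the current one, and `0 ∈ α`
means that a ball lands on the current beat. The number of balls is `α.card`.
`Step α β` is the condition `α_{i+1} ≤ β_i` for all `i ≥ 1`; together with
`α.card = β.card = b` it says that `α → β` is an edge of the `b`-ball state graph. -/
def Step (α β : Finset ℕ) : Prop :=
  ∀ i : ℕ, i + 1 ∈ α → i ∈ β

/-- A closed walk of length `n` (used for `1 ≤ n`) in the `b`-ball state graph: a juggling pattern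
of period `n` with a marked starting beat. -/
@[ext]
structure ClosedWalk (b n : ℕ) where
  state : ZMod n → Finset ℕ
  card_state : ∀ i, (state i).card = b
  step : ∀ i, Step (state i) (state (i + 1))

/-- A closed walk is prime if its `n` states are distinct. -/
def ClosedWalk.IsPrime {b n : ℕ} (W : ClosedWalk b n) : Prop :=
  Function.Injective W.state

/-- Two closed walks are the same cyclic pattern if one is a rotation of the other. -/
def ClosedWalk.IsRotation {b n : ℕ} (W W' : ClosedWalk b n) : Prop :=
  ∃ k : ZMod n, ∀ i, W'.state i = W.state (i + k)

/-- Prime closed walks up to rotation. -/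
def primeSetoid (b n : ℕ) : Setoid {W : ClosedWalk b n // W.IsPrime} where
  r W W' := W.1.IsRotation W'.1
  iseqv :=
    { refl := fun _ => ⟨0, fun i => by rw [add_zero]⟩
      symm := by
        rintro W W' ⟨k, hk⟩
        exact ⟨-k, fun i => by rw [hk, neg_add_cancel_right]⟩
      trans := by
        rintro W W' W'' ⟨k, hk⟩ ⟨l, hl⟩
        exact ⟨l + k, fun i => by rw [hl, hk, add_assoc]⟩ }

/-- `N'(b, n)`: the number of prime `b`-ball juggling patterns of period `n`, i.e. of directed
cycles of length `n` in the `b`-ball state graph. -/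
noncomputable def primeCount (b n : ℕ) : ℕ :=
  Nat.card (Quotient (primeSetoid b n))

/-! ### Juggling cards -/

/-- The index of the card of the transition `α → β`: it is `0` if no ball lands; otherwise the
thrown ball is the unique `k ∈ β` with `k + 1 ∉ α`, and the index is the position of that ball
among all balls of `β` (`1` for the ball that lands first). -/
def throwCard (α β : Finset ℕ) : ℕ :=
  if 0 ∈ α then
    ((β.filter fun k => k + 1 ∉ α).biUnion fun k => β.filter fun i => i ≤ k).card
  else 0

/-- The card sequence of a closed walk. -/
def ClosedWalk.cards {b n : ℕ} (W : ClosedWalk b n) (i : ZMod n) : ℕ :=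
  throwCard (W.state i) (W.state (i + 1))

/-! ### Filled Ferrers diagrams and landing words -/

/-- `D` lists the rows, from top to bottom, of a filled Ferrers diagram (each row from left to
right) of a partition of `n` into distinct parts; the parts are the row lengths.
Entries different from `b` and `b - 1` are then automatically in `{0, …, b - 2}`. -/
structure IsFilledDiagram (b n : ℕ) (D : List (List ℕ)) : Prop where
  strictly_decreasing : (D.map List.length).Pairwise (· > ·)
  row_ne_nil : ∀ r ∈ D, r ≠ []
  size : (D.map List.length).sum = n
  entry_le : ∀ r ∈ D, ∀ v ∈ r, v ≤ b
  rightmost : ∀ r ∈ D, r.getLast? = some b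
  not_rightmost : ∀ r ∈ D, b ∉ r.dropLast
  column : ∀ j : ℕ, ∀ r ∈ D, ∀ r' ∈ D,
    (r[j]? = some b ∨ r[j]? = some (b - 1)) →
      (r'[j]? = some b ∨ r'[j]? = some (b - 1)) → r = r'

/-- The landing word of an arrangement `R` of the rows: every row is read from right to left, and
the reversed rows are concatenated in the given order. -/
def landingList (R : List (List ℕ)) : List ℕ :=
  (R.map List.reverse).flatten

/-- The landing word as a cyclic word: the letter `w_{j+1}` sits at the residue `j`. -/
def landingWord (n : ℕ) (R : List (List ℕ)) (j : ZMod n) : ℕ :=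
  (landingList R).getD j.val 0

/-! ### The pattern generation algorithm -/

/-- The bump count after `s` steps to the left of the index `j`, where `u` is the current partial
assignment of cards (`none`: no card assigned yet; `some x`: the card `C_x`). -/
def bumpCount {n : ℕ} (u : ZMod n → Option ℕ) (j : ZMod n) : ℕ → ℕ
  | 0 => 0
  | s + 1 =>
    match u (j - ((s + 1 : ℕ) : ZMod n)) with
    | none => bumpCount u j s + 1
    | some x => if bumpCount u j s < x then bumpCount u j s + 1 else bumpCount u j s

open Classical in
/-- The first beat, moving left from `j`, at which the bump count reaches `v`; `none` if the search
does not terminate. -/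
noncomputable def throwBeat {n : ℕ} (u : ZMod n → Option ℕ) (v : ℕ) (j : ZMod n) :
    Option (ZMod n) :=
  if h : ∃ s : ℕ, bumpCount u j s = v then some (j - ((Nat.find h : ℕ) : ZMod n)) else none

/-- One round of the algorithm: assign the card `C_v`, `v = w j`, to the throw beat found
from `j`. -/
noncomputable def assignThrow {n : ℕ} (w : ZMod n → ℕ) (u : ZMod n → Option ℕ) (j : ZMod n) :
    Option (ZMod n → Option ℕ) :=
  (throwBeat u (w j) j).map fun k => Function.update u k (some (w j))

/-- The initial assignment: `C_0` wherever `w_j = 0`, nothing elsewhere. -/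
def initialCards {n : ℕ} (w : ZMod n → ℕ) (j : ZMod n) : Option ℕ :=
  if w j = 0 then some 0 else none

/-- The algorithm, treating the indices in the list `L` one after the other; `none` if one of the
searches does not terminate. -/
noncomputable def runAlgorithm {n : ℕ} (w : ZMod n → ℕ) (L : List (ZMod n)) :
    Option (ZMod n → Option ℕ) :=
  L.foldlM (assignThrow w) (initialCards w)

/-- An order in which the algorithm may treat the indices: every index with a nonzero letter once,
first those of `J₁`, then those of `J₂`, and so on; the order inside each `J_v` is free. -/
structure IsProcessingOrder {n : ℕ} (w : ZMod n → ℕ) (L : List (ZMod n)) : Prop where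
  nodup : L.Nodup
  mem_iff : ∀ j, j ∈ L ↔ w j ≠ 0
  sorted : L.Pairwise fun i j => w i ≤ w j

/-- The algorithm turns the word `w` into the card sequence `u`: whatever admissible order is
chosen, all searches terminate, and at the end every beat `j` carries the card `C_{u j}`. -/
def Produces {n : ℕ} (w u : ZMod n → ℕ) : Prop :=
  (∃ L, IsProcessingOrder w L) ∧
    ∀ L, IsProcessingOrder w L → runAlgorithm w L = some fun j => some (u j)

/-! ### Partitions into distinct parts -/

/-- All `(p_1, …, p_t)` with `p_1 > ⋯ > p_t ≥ 1` and `p_1 + ⋯ + p_t = n`; the part `p_{i+1}` is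
the value at `i : Fin t`. -/
def distinctPartitions (t n : ℕ) : Finset (Fin t → ℕ) :=
  (Finset.Nat.antidiagonalTuple t n).filter fun p =>
    (∀ i j : Fin t, i < j → p j < p i) ∧ ∀ i, 1 ≤ p i

end Juggling

/-!
A state is written as the increasing list of its landing times. A card determines the state before
a beat from the state after it (`pullBack`), so that a card sequence `u` acts on states backwards
in time. Going back through a card `C_b` makes two states share one more first entry
(`Agree.pullBack_length`), and all other cards keep the shared entries; after `b` cards `C_b` the
initial state is forgotten. Therefore each card sequence with letters at most `b` that contains `b`
belongs to exactly one closed walk (`exists_isTrace`, `IsTrace.unique`); conversely the cards of a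
closed walk contain `b` (`IsTrace.exists_card_eq`).

The algorithm inverts the passage from `u` to its landing word `landingLetter u`, whose letter at
`j` is the card that threw the ball landing at `j`. Going back from `j`, the bump count is the
number of balls that land before the traced ball, and it reaches the letter exactly at the throw
(`IsTrace.throwBeat_eq`); a card still missing is at least the current letter, hence counts as the
true card would. So the algorithm recovers `u` from its landing word (`IsTrace.produces`), and the
map from `u` to its landing word is injective. Both sides range over the words with letters at
most `b` that contain `b`, a finite set, so every such word is a landing word
(`exists_landingLetter_eq_word`). No analysis of the algorithm on an arbitrary word is needed.

Primality: the last ball of a state lands on a letter `b`, the one before it on `b` or `b - 1`, and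
no letter `b` lies in between (`IsTrace.landingLetter_ne`). If the letters `b` and `b - 1` have
different distances to the next `b`, the difference of the two last landing times thus determines
the beat of the state (`IsTrace.injective_of_isSeparated`). In the landing word of a diagram this
distance is the column of the cell, and a column contains at most one entry `b` or `b - 1`
(`IsFilledDiagram.isSeparated`).

Distinctness: rotating a walk rotates its landing word, and a cyclic word is cut into rows at its
letters `b` in only one way (`isRotated_of_rotate_flatten`).

The lower bound is the number of pairs of a diagram and a cyclic order of its rows. There are
`(t - 1)!` cyclic orders of `t` rows. With `q = b - 1`, a column of height `h` has `q ^ (h - 1)`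
fillings if a row ends in it and `q ^ (h - 1) * (q + h)` otherwise; the factors `(q + h) / q`
telescope over the rows that meet the column (`card_columns`), and exchanging the products over
rows and columns gives the stated sum (`card_diagrams`, `lowerBound_term`).
-/

namespace Juggling

/-! ### States as increasing lists -/

/-- The state before a beat with card `C_x`, computed from the state `l` after it: states are
written as increasing lists of landing times, the ball in position `x` is taken away (it is the one
that was thrown), all landings move one beat further away, and for `x ≠ 0` a ball lands now. -/
def pullBack : ℕ → List ℕ → List ℕ
  | 0, l => l.map (· + 1)
  | m + 1, l => 0 :: (l.eraseIdx m).map (· + 1)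

/-- The change of the bump count at a beat with card `C_x`. -/
def bump (x c : ℕ) : ℕ := if c < x then c + 1 else c

theorem getElem?_pullBack {x c d : ℕ} {l : List ℕ} (h : l[c]? = some d) (hc : c + 1 ≠ x) :
    (pullBack x l)[bump x c]? = some (d + 1) := by
  cases x with
  | zero => simp [pullBack, bump, h]
  | succ m =>
    unfold bump
    split_ifs with h1
    · have : c < m := by omega
      simp [pullBack, List.getElem?_eraseIdx, this, h]
    · obtain ⟨c, rfl⟩ : ∃ e, c = e + 1 := ⟨c - 1, by omega⟩
      have : ¬ c < m := by omega
      simp [pullBack, List.getElem?_eraseIdx, this, h]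

theorem exists_of_getElem?_pullBack {x c d : ℕ} {l : List ℕ}
    (h : (pullBack x l)[c]? = some (d + 1)) :
    ∃ c', l[c']? = some d ∧ c' + 1 ≠ x ∧ bump x c' = c := by
  cases x with
  | zero => exact ⟨c, by simpa [pullBack] using h, by simp, by simp [bump]⟩
  | succ m =>
    cases c with
    | zero => simp [pullBack] at h
    | succ c =>
      simp only [pullBack, List.getElem?_cons_succ, List.getElem?_map, List.getElem?_eraseIdx] at h
      split_ifs at h with h1
      · exact ⟨c, by simpa using h, by omega, by unfold bump; split_ifs <;> omega⟩
      · exact ⟨c + 1, by simpa using h, by omega, by unfold bump; split_ifs <;> omega⟩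

theorem getElem?_pullBack_eq_zero {x c : ℕ} {l : List ℕ} :
    (pullBack x l)[c]? = some 0 ↔ c = 0 ∧ x ≠ 0 := by
  cases x with
  | zero => simp [pullBack]
  | succ m => cases c <;> simp [pullBack]

theorem succ_mem_pullBack {x d : ℕ} {l : List ℕ} :
    d + 1 ∈ pullBack x l ↔ ∃ c, l[c]? = some d ∧ c + 1 ≠ x := by
  rw [List.mem_iff_getElem?]
  constructor
  · rintro ⟨c, hc⟩
    obtain ⟨c', h1, h2, -⟩ := exists_of_getElem?_pullBack hc
    exact ⟨c', h1, h2⟩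
  · rintro ⟨c, h1, h2⟩
    exact ⟨_, getElem?_pullBack h1 h2⟩

theorem zero_mem_pullBack {x : ℕ} {l : List ℕ} : 0 ∈ pullBack x l ↔ x ≠ 0 := by
  simp [List.mem_iff_getElem?, getElem?_pullBack_eq_zero]

theorem length_pullBack {x : ℕ} {l : List ℕ} (h : x ≤ l.length) :
    (pullBack x l).length = l.length := by
  cases x with
  | zero => simp [pullBack]
  | succ m =>
    simp only [pullBack, List.length_cons, List.length_map, List.length_eraseIdx]
    split_ifs <;> omega

theorem pairwise_pullBack {x : ℕ} {l : List ℕ} (h : l.Pairwise (· < ·)) :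
    (pullBack x l).Pairwise (· < ·) := by
  cases x with
  | zero => simpa [pullBack, List.pairwise_map] using h
  | succ m =>
    have := h.sublist (List.eraseIdx_sublist l m)
    simpa [pullBack, List.pairwise_map] using this

theorem index_unique {l : List ℕ} (h : l.Pairwise (· < ·)) {c c' d : ℕ}
    (h1 : l[c]? = some d) (h2 : l[c']? = some d) : c = c' := by
  obtain ⟨hc, h1⟩ := List.getElem?_eq_some_iff.1 h1
  obtain ⟨hc', h2⟩ := List.getElem?_eq_some_iff.1 h2
  exact (List.Nodup.getElem_inj_iff (h.imp fun h => ne_of_lt h)).1 (h1.trans h2.symm)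

theorem index_lt {l : List ℕ} (h : l.Pairwise (· < ·)) {c c' d d' : ℕ}
    (h1 : l[c]? = some d) (h2 : l[c']? = some d') (hd : d < d') : c < c' := by
  obtain ⟨hc, h1⟩ := List.getElem?_eq_some_iff.1 h1
  obtain ⟨hc', h2⟩ := List.getElem?_eq_some_iff.1 h2
  by_contra hcc
  rcases (not_lt.1 hcc).eq_or_lt with h0 | h0
  · subst h0; omega
  · have := List.pairwise_iff_getElem.1 h _ _ hc' hc h0
    omega

theorem entry_lt {l : List ℕ} (h : l.Pairwise (· < ·)) {c c' d d' : ℕ}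
    (h1 : l[c]? = some d) (h2 : l[c']? = some d') (hd : c < c') : d < d' := by
  obtain ⟨hc, h1⟩ := List.getElem?_eq_some_iff.1 h1
  obtain ⟨hc', h2⟩ := List.getElem?_eq_some_iff.1 h2
  have := List.pairwise_iff_getElem.1 h _ _ hc hc' hd
  omega

theorem step_pullBack (x : ℕ) (l : List ℕ) : Step (pullBack x l).toFinset l.toFinset := by
  intro d hd
  rw [List.mem_toFinset, succ_mem_pullBack] at hd
  obtain ⟨c, hc, -⟩ := hd
  exact List.mem_toFinset.2 (List.mem_of_getElem? hc)

theorem throwCard_pullBack {x : ℕ} {l : List ℕ} (hl : l.Pairwise (· < ·)) (hx : x ≤ l.length) :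
    throwCard (pullBack x l).toFinset l.toFinset = x := by
  unfold throwCard
  rcases x with _ | m
  · simp [zero_mem_pullBack]
  · rw [if_pos (by simp [zero_mem_pullBack])]
    have hm : l[m]? = some l[m] := List.getElem?_eq_getElem hx
    have h1 : (l.toFinset.filter fun k => k + 1 ∉ (pullBack (m + 1) l).toFinset) = {l[m]} := by
      ext k
      simp only [Finset.mem_filter, List.mem_toFinset, succ_mem_pullBack, Finset.mem_singleton]
      constructor
      · rintro ⟨hk, hk'⟩
        obtain ⟨c, hc⟩ := List.mem_iff_getElem?.1 hk
        by_contra hne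
        refine hk' ⟨c, hc, fun h => hne ?_⟩
        obtain rfl : c = m := by omega
        exact Option.some_injective _ (hc.symm.trans hm)
      · rintro rfl
        refine ⟨List.getElem_mem _, ?_⟩
        rintro ⟨c, hc, hne⟩
        exact hne (by rw [index_unique hl hc hm])
    rw [h1, Finset.singleton_biUnion]
    have h2 : (l.toFinset.filter fun i => i ≤ l[m]) = (l.take (m + 1)).toFinset := by
      ext k
      simp only [Finset.mem_filter, List.mem_toFinset, List.mem_iff_getElem?, List.getElem?_take]
      constructor
      · rintro ⟨⟨c, hc⟩, hk⟩
        refine ⟨c, ?_⟩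
        rw [if_pos, hc]
        by_contra hlt
        have := entry_lt hl hm hc (by omega)
        omega
      · rintro ⟨c, hc⟩
        split_ifs at hc with h3
        refine ⟨⟨c, hc⟩, ?_⟩
        by_contra hlt
        have := index_lt hl hm hc (by omega)
        omega
    rw [h2, List.toFinset_card_of_nodup]
    · simp; omega
    · exact ((hl.imp fun h => ne_of_lt h).sublist (List.take_sublist _ _))

/-- Every edge of the state graph arises from `pullBack`. -/
theorem Step.sort_eq_pullBack {α β : Finset ℕ} (h : Step α β) (hc : α.card = β.card) :
    throwCard α β ≤ β.card ∧ α.sort = pullBack (throwCard α β) β.sort := by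
  have hβ : β.sort.Pairwise (· < ·) := (Finset.sortedLT_sort β).pairwise
  have key : ∃ x ≤ β.card, α = (pullBack x β.sort).toFinset := by
    by_cases h0 : 0 ∈ α
    · obtain ⟨k, hk, hkα⟩ : ∃ k ∈ β, k + 1 ∉ α := by
        by_contra! hcon
        have hsub : insert 0 (β.image (· + 1)) ⊆ α := by
          intro d hd
          rcases Finset.mem_insert.1 hd with rfl | hd
          · exact h0
          · obtain ⟨k, hk, rfl⟩ := Finset.mem_image.1 hd
            exact hcon k hk
        have := Finset.card_le_card hsub
        rw [Finset.card_insert_of_notMem (by simp),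
          Finset.card_image_of_injective _ (add_left_injective 1)] at this
        omega
      obtain ⟨m, hm⟩ := List.mem_iff_getElem?.1 ((Finset.mem_sort (· ≤ ·)).2 hk)
      have hmlt : m < β.sort.length := (List.getElem?_eq_some_iff.1 hm).1
      rw [Finset.length_sort] at hmlt
      refine ⟨m + 1, hmlt, ?_⟩
      refine Finset.eq_of_subset_of_card_le ?_ ?_
      · intro d hd
        rw [List.mem_toFinset]
        cases d with
        | zero => simp [zero_mem_pullBack]
        | succ d =>
          obtain ⟨c, hcd⟩ := List.mem_iff_getElem?.1 ((Finset.mem_sort (· ≤ ·)).2 (h d hd))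
          refine succ_mem_pullBack.2 ⟨c, hcd, fun hcm => hkα ?_⟩
          obtain rfl : c = m := by omega
          rwa [← Option.some_injective _ (hcd.symm.trans hm)]
      · refine (List.toFinset_card_le _).trans ?_
        rw [length_pullBack (by simpa using hmlt), Finset.length_sort, hc]
    · refine ⟨0, Nat.zero_le _, Finset.eq_of_subset_of_card_le ?_ ?_⟩
      · intro d hd
        rw [List.mem_toFinset]
        cases d with
        | zero => exact absurd hd h0
        | succ d =>
          obtain ⟨c, hcd⟩ := List.mem_iff_getElem?.1 ((Finset.mem_sort (· ≤ ·)).2 (h d hd))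
          exact succ_mem_pullBack.2 ⟨c, hcd, by simp⟩
      · refine (List.toFinset_card_le _).trans ?_
        rw [length_pullBack (by simp), Finset.length_sort, hc]
  obtain ⟨x, hx, rfl⟩ := key
  have hβ' : β.sort.toFinset = β := Finset.sort_toFinset _ _
  have hcard := throwCard_pullBack hβ (x := x) (by simpa using hx)
  rw [hβ'] at hcard
  rw [hcard]
  refine ⟨hx, ?_⟩
  have hp := pairwise_pullBack (x := x) hβ
  exact (List.toFinset_sort (· ≤ ·) (hp.imp fun h => ne_of_lt h)).2 (hp.imp fun h => le_of_lt h)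

/-! ### Closed walks and card sequences -/

/-- The lists `ℓ i` are the states, as increasing lists, of a closed walk with cards `u i`. -/
structure IsTrace {n : ℕ} (b : ℕ) (u : ZMod n → ℕ) (ℓ : ZMod n → List ℕ) : Prop where
  length : ∀ i, (ℓ i).length = b
  pairwise : ∀ i, (ℓ i).Pairwise (· < ·)
  card_le : ∀ i, u i ≤ b
  eq_pullBack : ∀ i, ℓ i = pullBack (u i) (ℓ (i + 1))

theorem ClosedWalk.isTrace {b n : ℕ} (W : ClosedWalk b n) :
    IsTrace b W.cards fun i => (W.state i).sort where
  length i := by simp [W.card_state]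
  pairwise i := (Finset.sortedLT_sort _).pairwise
  card_le i := by
    have := ((W.step i).sort_eq_pullBack (by simp [W.card_state])).1
    rwa [W.card_state] at this
  eq_pullBack i := ((W.step i).sort_eq_pullBack (by simp [W.card_state])).2

/-- The closed walk with given states. -/
def IsTrace.walk {b n : ℕ} {u : ZMod n → ℕ} {ℓ : ZMod n → List ℕ} (h : IsTrace b u ℓ) :
    ClosedWalk b n where
  state i := (ℓ i).toFinset
  card_state i := by
    rw [List.toFinset_card_of_nodup ((h.pairwise i).imp fun h => ne_of_lt h), h.length]
  step i := by
    rw [h.eq_pullBack i]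
    exact step_pullBack _ _

theorem IsTrace.cards_walk {b n : ℕ} {u : ZMod n → ℕ} {ℓ : ZMod n → List ℕ}
    (h : IsTrace b u ℓ) : h.walk.cards = u := by
  funext i
  change throwCard (ℓ i).toFinset (ℓ (i + 1)).toFinset = u i
  rw [h.eq_pullBack i]
  exact throwCard_pullBack (h.pairwise _) (by rw [h.length]; exact h.card_le i)

/-- Without a card `C_b` the ball that lands last would never come closer to its landing. -/
theorem IsTrace.exists_card_eq {b n : ℕ} [NeZero n] {u : ZMod n → ℕ} {ℓ : ZMod n → List ℕ}
    (h : IsTrace b u ℓ) (hb : 1 ≤ b) : ∃ i, u i = b := by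
  by_contra! hne
  have hlen : ∀ i, b - 1 < (ℓ i).length := fun i => by rw [h.length]; omega
  have hstep : ∀ i, (ℓ i)[b - 1]'(hlen i) = (ℓ (i + 1))[b - 1]'(hlen _) + 1 := by
    intro i
    have h1 := getElem?_pullBack (x := u i)
      (List.getElem?_eq_getElem (hlen (i + 1))) (by have := hne i; omega)
    rw [← h.eq_pullBack i] at h1
    have h2 := h.card_le i
    have h3 := hne i
    have h4 : bump (u i) (b - 1) = b - 1 := if_neg (by omega)
    rw [h4] at h1
    exact (List.getElem?_eq_some_iff.1 h1).2
  have hsum := Finset.sum_congr rfl fun i (_ : i ∈ (Finset.univ : Finset (ZMod n))) => hstep i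
  rw [Finset.sum_add_distrib, Fintype.sum_equiv (Equiv.addRight (1 : ZMod n))
    (fun i => (ℓ (i + 1))[b - 1]'(hlen _)) (fun i => (ℓ i)[b - 1]'(hlen _)) fun i => rfl] at hsum
  simp at hsum
  exact NeZero.ne n hsum

/-- Two lists have the same first `k` entries. -/
def Agree (k : ℕ) (l l' : List ℕ) : Prop := ∀ c < k, l[c]? = l'[c]?

theorem Agree.pullBack {k x : ℕ} {l l' : List ℕ} (h : Agree k l l') :
    Agree k (pullBack x l) (pullBack x l') := by
  intro c hc
  cases x with
  | zero => simp [Juggling.pullBack, h c hc]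
  | succ m =>
    cases c with
    | zero => simp [Juggling.pullBack]
    | succ c =>
      simp [Juggling.pullBack, List.getElem?_eraseIdx, h c (by omega), h (c + 1) hc]

/-- A card `C_b` removes the last ball, so that one more entry is shared. -/
theorem Agree.pullBack_length {k b : ℕ} {l l' : List ℕ} (h : Agree k l l') (hb : 1 ≤ b)
    (hl : l.length = b) (hl' : l'.length = b) :
    Agree (k + 1) (Juggling.pullBack b l) (Juggling.pullBack b l') := by
  intro c hc
  obtain ⟨m, rfl⟩ : ∃ m, b = m + 1 := ⟨b - 1, by omega⟩
  cases c with
  | zero => simp [Juggling.pullBack]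
  | succ c =>
    simp only [Juggling.pullBack, List.getElem?_cons_succ, List.getElem?_map,
      List.getElem?_eraseIdx]
    split_ifs
    · rw [h c (by omega)]
    · rw [List.getElem?_eq_none (by omega), List.getElem?_eq_none (by omega)]

/-- The first landings forget the initial state: two sequences of states obtained by `pullBack`
along the same cards share one more entry after every card `C_b`. -/
theorem eq_of_pullBack_iterate {b n : ℕ} (hb : 1 ≤ b) {v : ℕ → ℕ} {a a' : ℕ → List ℕ}
    (ha : ∀ N, a (N + 1) = pullBack (v N) (a N)) (ha' : ∀ N, a' (N + 1) = pullBack (v N) (a' N))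
    (hl : ∀ N, (a N).length = b) (hl' : ∀ N, (a' N).length = b)
    (hv : ∀ N, ∃ M, N ≤ M ∧ M < N + n ∧ v M = b) : a (n * b) = a' (n * b) := by
  have mono : ∀ k N M, Agree k (a N) (a' N) → Agree k (a (N + M)) (a' (N + M)) := by
    intro k N M h
    induction M with
    | zero => exact h
    | succ M ih => rw [← add_assoc, ha, ha']; exact ih.pullBack
  have main : ∀ k, Agree k (a (n * k)) (a' (n * k)) := by
    intro k
    induction k with
    | zero => intro c hc; omega
    | succ k ih =>
      obtain ⟨M, h1, h2, h3⟩ := hv (n * k)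
      have h4 := mono k _ (M - n * k) ih
      rw [Nat.add_sub_cancel' h1] at h4
      have h5 := h4.pullBack_length hb (hl M) (hl' M)
      rw [show pullBack b = pullBack (v M) by rw [h3], ← ha, ← ha'] at h5
      have h6 := mono _ _ (n * k + n - (M + 1)) h5
      rwa [Nat.add_sub_cancel' (by omega), ← Nat.mul_succ] at h6
  refine List.ext_getElem? fun c => ?_
  by_cases hc : c < b
  · exact main b c hc
  · rw [List.getElem?_eq_none (by rw [hl]; omega), List.getElem?_eq_none (by rw [hl']; omega)]

theorem exists_index_of_card {b n : ℕ} [NeZero n] {u : ZMod n → ℕ} (hu : ∃ i, u i = b)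
    (i : ZMod n) (N : ℕ) : ∃ M : ℕ, N ≤ M ∧ M < N + n ∧ u (i - M - 1) = b := by
  obtain ⟨j, hj⟩ := hu
  have hlt := ZMod.val_lt (i - (N : ZMod n) - 1 - j)
  refine ⟨N + (i - (N : ZMod n) - 1 - j).val, by omega, by omega, ?_⟩
  rw [← hj]
  push_cast
  rw [ZMod.natCast_zmod_val]
  congr 1
  ring

theorem IsTrace.unique {b n : ℕ} [NeZero n] (hb : 1 ≤ b) {u : ZMod n → ℕ}
    {ℓ ℓ' : ZMod n → List ℕ} (h : IsTrace b u ℓ) (h' : IsTrace b u ℓ') : ℓ = ℓ' := by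
  funext i
  have hrec : ∀ {k : ZMod n → List ℕ}, IsTrace b u k → ∀ N : ℕ,
      k (i - (N + 1 : ℕ)) = pullBack (u (i - N - 1)) (k (i - N)) := by
    intro k hk N
    rw [hk.eq_pullBack]
    push_cast
    congr 2 <;> ring_nf
  have := eq_of_pullBack_iterate (n := n) hb (v := fun N => u (i - N - 1))
    (a := fun N => ℓ (i - N)) (a' := fun N => ℓ' (i - N)) (hrec h) (hrec h')
    (fun N => h.length _) (fun N => h'.length _) (exists_index_of_card (h.exists_card_eq hb) i)
  simpa using this

/-- The state reached from the state `0, …, b - 1` at `i` by going back `N` beats. -/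
def backStates {n : ℕ} (b : ℕ) (u : ZMod n → ℕ) (i : ZMod n) : ℕ → List ℕ
  | 0 => List.range b
  | N + 1 => pullBack (u (i - N - 1)) (backStates b u i N)

theorem exists_isTrace {b n : ℕ} [NeZero n] (hb : 1 ≤ b) {u : ZMod n → ℕ}
    (hle : ∀ i, u i ≤ b) (hu : ∃ i, u i = b) : ∃ ℓ, IsTrace b u ℓ := by
  have hlen : ∀ i N, (backStates b u i N).length = b := by
    intro i N
    induction N with
    | zero => simp [backStates]
    | succ N ih => rw [backStates, length_pullBack (by rw [ih]; exact hle _), ih]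
  refine ⟨fun i => backStates b u i (n * b), fun i => hlen _ _, fun i => ?_, hle, fun i => ?_⟩
  · induction n * b with
    | zero => exact List.pairwise_lt_range
    | succ N ih => exact pairwise_pullBack ih
  · have := eq_of_pullBack_iterate (n := n) hb (v := fun N => u (i - N - 1))
      (a := fun N => backStates b u i N) (a' := fun N => backStates b u (i + 1) (N + 1))
      (fun N => rfl) (fun N => by
        rw [backStates]
        congr 2
        push_cast
        ring) (fun N => hlen _ _) (fun N => hlen _ _) (exists_index_of_card hu i)
    refine this.trans ?_
    rw [backStates]
    congr 2
    push_cast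
    simp

theorem ClosedWalk.ext_cards {b n : ℕ} [NeZero n] (hb : 1 ≤ b) {W W' : ClosedWalk b n}
    (h : W.cards = W'.cards) : W = W' := by
  have h1 := W.isTrace
  rw [h] at h1
  have h2 := IsTrace.unique hb h1 W'.isTrace
  ext1
  funext i
  have := congrArg List.toFinset (congrFun h2 i)
  simpa using this

/-! ### Tracing balls back from their landing -/

/-- The bump count of the algorithm, run along a complete card sequence. -/
def count {n : ℕ} (u : ZMod n → ℕ) (j : ZMod n) (s : ℕ) : ℕ :=
  bumpCount (fun p => some (u p)) j s

theorem count_zero {n : ℕ} (u : ZMod n → ℕ) (j : ZMod n) : count u j 0 = 0 := rfl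

theorem count_succ {n : ℕ} (u : ZMod n → ℕ) (j : ZMod n) (s : ℕ) :
    count u j (s + 1) = bump (u (j - (s + 1 : ℕ))) (count u j s) := rfl

theorem le_bump (x c : ℕ) : c ≤ bump x c := by unfold bump; split_ifs <;> omega

theorem count_mono {n : ℕ} (u : ZMod n → ℕ) (j : ZMod n) : Monotone (count u j) :=
  monotone_nat_of_le_succ fun s => by rw [count_succ]; exact le_bump _ _

/-- The ball landing at `j` is thrown at the first beat, going back from `j`, whose card puts the
thrown ball where the traced ball is; `flight u j` beats lie strictly between throw and landing. -/
noncomputable def flight {n : ℕ} (u : ZMod n → ℕ) (j : ZMod n) : ℕ :=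
  sInf {s | count u j s + 1 = u (j - (s + 1 : ℕ))}

/-- The beat at which the ball landing at `j` is thrown. -/
noncomputable def throwTime {n : ℕ} (u : ZMod n → ℕ) (j : ZMod n) : ZMod n :=
  j - (flight u j + 1 : ℕ)

/-- The landing word of a card sequence: at each beat the index of the card that threw the ball
landing there, and `0` if no ball lands. -/
noncomputable def landingLetter {n : ℕ} (u : ZMod n → ℕ) (j : ZMod n) : ℕ :=
  if u j = 0 then 0 else u (throwTime u j)

theorem ne_of_lt_flight {n : ℕ} {u : ZMod n → ℕ} {j : ZMod n} {s : ℕ} (hs : s < flight u j) :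
    count u j s + 1 ≠ u (j - (s + 1 : ℕ)) :=
  Nat.notMem_of_lt_sInf (s := {s | count u j s + 1 = u (j - (s + 1 : ℕ))}) hs

namespace IsTrace

variable {b n : ℕ} {u : ZMod n → ℕ} {ℓ : ZMod n → List ℕ} (h : IsTrace b u ℓ)
include h

theorem getElem?_count {j : ZMod n} (hj : u j ≠ 0) {s : ℕ}
    (hs : ∀ r < s, count u j r + 1 ≠ u (j - (r + 1 : ℕ))) :
    (ℓ (j - s))[count u j s]? = some s := by
  induction s with
  | zero =>
    rw [h.eq_pullBack, count_zero, getElem?_pullBack_eq_zero]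
    simpa using hj
  | succ s ih =>
    have h1 := getElem?_pullBack (ih fun r hr => hs r (by omega)) (hs s (by omega))
    rw [h.eq_pullBack, count_succ]
    convert h1 using 3
    push_cast
    ring_nf

/-- Otherwise the ball would be in the air at all times, with unbounded landing times. -/
theorem exists_throw [NeZero n] {j : ZMod n} (hj : u j ≠ 0) :
    ∃ s, count u j s + 1 = u (j - (s + 1 : ℕ)) := by
  by_contra! hne
  set B := ∑ i, (ℓ i).sum with hB
  have h1 := List.mem_of_getElem? (h.getElem?_count hj (s := B + 1) fun r _ => hne r)
  have h2 := List.le_sum_of_mem h1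
  have h3 := Finset.single_le_sum (f := fun i => (ℓ i).sum) (fun i _ => Nat.zero_le _)
    (Finset.mem_univ (j - ((B + 1 : ℕ) : ZMod n)))
  exact absurd (h2.trans h3) (by omega)

theorem count_flight [NeZero n] {j : ZMod n} (hj : u j ≠ 0) :
    count u j (flight u j) + 1 = u (throwTime u j) :=
  Nat.sInf_mem (h.exists_throw hj)

theorem getElem?_state {j : ZMod n} (hj : u j ≠ 0) {s : ℕ} (hs : s ≤ flight u j) :
    (ℓ (j - s))[count u j s]? = some s :=
  h.getElem?_count hj fun _ hr => ne_of_lt_flight (by omega)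

theorem count_lt_landingLetter [NeZero n] {j : ZMod n} (hj : u j ≠ 0) {s : ℕ}
    (hs : s ≤ flight u j) : count u j s < landingLetter u j := by
  rw [landingLetter, if_neg hj, ← h.count_flight hj]
  exact Nat.lt_succ_of_le (count_mono u j hs)

/-- The balls in the air at `i` are those whose flight covers `i`. -/
theorem of_getElem?_eq [NeZero n] {i : ZMod n} {c d : ℕ} (hd : (ℓ i)[c]? = some d) :
    u (i + d) ≠ 0 ∧ d ≤ flight u (i + d) ∧ count u (i + d) d = c := by
  have key : u (i + d) ≠ 0 ∧ (∀ s < d, count u (i + d) s + 1 ≠ u (i + d - (s + 1 : ℕ))) ∧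
      count u (i + d) d = c := by
    induction d generalizing i c with
    | zero =>
      rw [h.eq_pullBack, getElem?_pullBack_eq_zero] at hd
      simp [hd, count_zero]
    | succ d ih =>
      rw [h.eq_pullBack] at hd
      obtain ⟨c', h1, h2, h3⟩ := exists_of_getElem?_pullBack hd
      obtain ⟨h4, h5, h6⟩ := ih h1
      have hij : i + ((d + 1 : ℕ) : ZMod n) = i + 1 + d := by push_cast; ring
      have hi : i + 1 + (d : ZMod n) - ((d + 1 : ℕ) : ZMod n) = i := by push_cast; ring
      rw [hij, count_succ, hi, h6]
      refine ⟨h4, fun s hs => ?_, h3⟩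
      rcases Nat.lt_succ_iff_lt_or_eq.1 hs with hs | rfl
      · exact h5 s hs
      · rwa [hi, h6]
  refine ⟨key.1, ?_, key.2.2⟩
  by_contra hlt
  exact key.2.1 _ (not_le.1 hlt) (h.count_flight key.1)

theorem throwTime_injective [NeZero n] {j j' : ZMod n} (hj : u j ≠ 0) (hj' : u j' ≠ 0)
    (hjj : throwTime u j = throwTime u j') : j = j' := by
  have key : ∀ {j : ZMod n}, u j ≠ 0 →
      (ℓ (throwTime u j + 1))[u (throwTime u j) - 1]? = some (flight u j) := by
    intro j hj
    rw [← h.count_flight hj, Nat.add_sub_cancel, ← h.getElem?_state hj le_rfl, throwTime]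
    congr 2
    push_cast
    ring
  have h1 := key hj
  rw [hjj, key hj'] at h1
  have h2 := Option.some_injective _ h1
  rw [throwTime, throwTime, h2] at hjj
  simpa using hjj

theorem throwTime_ne_zero [NeZero n] {j : ZMod n} (hj : u j ≠ 0) : u (throwTime u j) ≠ 0 := by
  rw [← h.count_flight hj]
  omega

theorem exists_throwTime_eq [NeZero n] {k : ZMod n} (hk : u k ≠ 0) :
    ∃ j, u j ≠ 0 ∧ throwTime u j = k := by
  let f : {j // u j ≠ 0} → {j // u j ≠ 0} := fun j => ⟨throwTime u j, h.throwTime_ne_zero j.2⟩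
  have hf : Function.Injective f := fun j j' hjj =>
    Subtype.ext (h.throwTime_injective j.2 j'.2 (congrArg Subtype.val hjj))
  obtain ⟨j, hj⟩ := Finite.surjective_of_injective hf ⟨k, hk⟩
  exact ⟨j, j.2, congrArg Subtype.val hj⟩

theorem landingLetter_eq_zero [NeZero n] {j : ZMod n} : landingLetter u j = 0 ↔ u j = 0 := by
  unfold landingLetter
  split_ifs with hj
  · simp [hj]
  · simpa [hj] using h.throwTime_ne_zero hj

theorem landingLetter_le {j : ZMod n} : landingLetter u j ≤ b := by
  unfold landingLetter
  split_ifs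
  · exact Nat.zero_le _
  · exact h.card_le _

theorem exists_landingLetter_eq [NeZero n] (hb : 1 ≤ b) : ∃ j, landingLetter u j = b := by
  obtain ⟨k, hk⟩ := h.exists_card_eq hb
  obtain ⟨j, hj, rfl⟩ := h.exists_throwTime_eq (k := k) (by omega)
  exact ⟨j, by rw [landingLetter, if_neg hj, hk]⟩

/-- The algorithm stops exactly at the throw of the ball landing at `j`, provided that the cards
that are still missing are at least the one it is going to assign. -/
theorem throwBeat_eq [NeZero n] {j : ZMod n} (hj : u j ≠ 0) {a : ZMod n → Option ℕ}
    (ha : ∀ p, a p = some (u p) ∨ a p = none ∧ landingLetter u j ≤ u p) :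
    throwBeat a (landingLetter u j) j = some (throwTime u j) := by
  have h1 : ∀ s ≤ flight u j + 1, bumpCount a j s = count u j s := by
    intro s hs
    induction s with
    | zero => rfl
    | succ s ih =>
      have h2 := h.count_lt_landingLetter hj (s := s) (by omega)
      rw [count_succ, bumpCount, ih (by omega)]
      rcases ha (j - (s + 1 : ℕ)) with h3 | ⟨h3, h4⟩
      · rw [h3]; rfl
      · rw [h3, bump, if_pos (by omega)]
  have h5 : bumpCount a j (flight u j + 1) = landingLetter u j := by
    rw [h1 _ le_rfl, count_succ, landingLetter, if_neg hj, ← h.count_flight hj]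
    have := h.count_flight hj
    rw [throwTime] at this
    rw [← this, bump, if_pos (by omega)]
  unfold throwBeat
  rw [dif_pos ⟨_, h5⟩]
  refine congrArg (fun s : ℕ => some (j - (s : ZMod n)))
    ((Nat.find_eq_iff _).2 ⟨h5, fun m hm => ?_⟩)
  rw [h1 m (by omega)]
  exact (h.count_lt_landingLetter hj (by omega)).ne

end IsTrace

/-- The cards assigned once the landings in `L` have been treated. -/
noncomputable def partialCards {n : ℕ} (u : ZMod n → ℕ) (L : List (ZMod n)) (p : ZMod n) :
    Option ℕ :=
  if u p = 0 ∨ ∃ j ∈ L, throwTime u j = p then some (u p) else none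

theorem exists_isProcessingOrder {n : ℕ} [NeZero n] (w : ZMod n → ℕ) :
    ∃ L, IsProcessingOrder w L := by
  classical
  let r : ZMod n → ZMod n → Prop := fun i j => w i ≤ w j
  have : Std.Total r := ⟨fun i j => le_total (w i) (w j)⟩
  have : IsTrans (ZMod n) r := ⟨fun i j k => le_trans⟩
  let L := (Finset.univ.filter fun j : ZMod n => w j ≠ 0).toList.insertionSort r
  have hp : L.Perm _ := List.perm_insertionSort r _
  exact ⟨L, hp.nodup_iff.2 (Finset.nodup_toList _), fun j => by rw [hp.mem_iff]; simp,
    List.pairwise_insertionSort r _⟩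

/-- The algorithm recovers a card sequence from its landing word. -/
theorem IsTrace.produces {b n : ℕ} [NeZero n] {u : ZMod n → ℕ} {ℓ : ZMod n → List ℕ}
    (h : IsTrace b u ℓ) : Produces (landingLetter u) u := by
  refine ⟨exists_isProcessingOrder _, fun L hL => ?_⟩
  have main : ∀ L₂ L₁, L = L₁ ++ L₂ →
      L₂.foldlM (assignThrow (landingLetter u)) (partialCards u L₁) =
        some (partialCards u L) := by
    intro L₂
    induction L₂ with
    | nil => rintro L₁ rfl; simp
    | cons j L₂ ih =>
      intro L₁ hL₁
      have hmem : j ∈ L := by simp [hL₁]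
      have hj : u j ≠ 0 := fun h0 => (hL.mem_iff j).1 hmem (h.landingLetter_eq_zero.2 h0)
      have h1 : throwBeat (partialCards u L₁) (landingLetter u j) j = some (throwTime u j) := by
        refine h.throwBeat_eq hj fun p => ?_
        unfold partialCards
        split_ifs with hp
        · exact Or.inl rfl
        · refine Or.inr ⟨rfl, ?_⟩
          push Not at hp
          obtain ⟨k, hk, rfl⟩ := h.exists_throwTime_eq hp.1
          have hkL : k ∈ L := (hL.mem_iff k).2 fun h0 => hk (h.landingLetter_eq_zero.1 h0)
          rw [hL₁, List.mem_append] at hkL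
          have hk2 : k ∈ j :: L₂ := hkL.resolve_left fun hk1 => hp.2 k hk1 rfl
          have hk3 : u (throwTime u k) = landingLetter u k := by rw [landingLetter, if_neg hk]
          rw [hk3]
          rcases List.mem_cons.1 hk2 with rfl | hk2
          · exact le_rfl
          · have := hL.sorted
            rw [hL₁] at this
            exact (List.pairwise_cons.1 (List.pairwise_append.1 this).2.1).1 k hk2
      have h2 : Function.update (partialCards u L₁) (throwTime u j) (some (landingLetter u j)) =
          partialCards u (L₁ ++ [j]) := by
        funext p
        by_cases hp : p = throwTime u j
        · subst hp
          rw [Function.update_self, partialCards, if_pos (Or.inr ⟨j, by simp, rfl⟩),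
            landingLetter, if_neg hj]
        · rw [Function.update_of_ne hp, partialCards, partialCards]
          congr 1
          simp [eq_comm, or_and_right, exists_or, hp]
      rw [List.foldlM_cons, assignThrow, h1, Option.map_some, h2]
      exact ih _ (by simp [hL₁])
  have h0 : initialCards (landingLetter u) = partialCards u [] := by
    funext p
    simp only [initialCards, partialCards, h.landingLetter_eq_zero]
    by_cases hp : u p = 0 <;> simp [hp]
  rw [runAlgorithm, h0, main L [] rfl]
  congr 1
  funext p
  rw [partialCards, if_pos]
  by_cases hp : u p = 0
  · exact Or.inl hp
  · obtain ⟨j, hj, rfl⟩ := h.exists_throwTime_eq hp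
    exact Or.inr ⟨j, (hL.mem_iff j).2 fun h0 => hj (h.landingLetter_eq_zero.1 h0), rfl⟩

theorem Produces.unique {n : ℕ} {w u u' : ZMod n → ℕ} (h : Produces w u) (h' : Produces w u') :
    u = u' := by
  obtain ⟨L, hL⟩ := h.1
  have h1 := (h.2 L hL).symm.trans (h'.2 L hL)
  funext j
  exact Option.some_injective _ (congrFun (Option.some_injective _ h1) j)

/-- Card sequences and landing words range over the same finite set, and the algorithm is a left
inverse of the passage from cards to landing words; hence every word is a landing word. -/
theorem exists_landingLetter_eq_word {b n : ℕ} [NeZero n] (hb : 1 ≤ b) {w : ZMod n → ℕ}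
    (hle : ∀ i, w i ≤ b) (hw : ∃ i, w i = b) :
    ∃ u ℓ, IsTrace b u ℓ ∧ landingLetter u = w := by
  let X := {w : ZMod n → ℕ // (∀ i, w i ≤ b) ∧ ∃ i, w i = b}
  have hX : Finite X := by
    refine Finite.of_injective
      (fun w : X => fun i => (⟨w.1 i, Nat.lt_succ_of_le (w.2.1 i)⟩ : Fin (b + 1))) fun w w' hww => ?_
    refine Subtype.ext (funext fun i => ?_)
    exact congrArg Fin.val (congrFun hww i)
  have htr : ∀ u : X, ∃ ℓ, IsTrace b u.1 ℓ := fun u => exists_isTrace hb u.2.1 u.2.2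
  choose ℓ hℓ using htr
  let f : X → X := fun u => ⟨landingLetter u.1, fun i => (hℓ u).landingLetter_le,
    (hℓ u).exists_landingLetter_eq hb⟩
  have hf : Function.Injective f := by
    intro u u' huu
    have h1 := (hℓ u).produces
    have h2 := (hℓ u').produces
    rw [show landingLetter u.1 = landingLetter u'.1 from congrArg Subtype.val huu] at h1
    exact Subtype.ext (h1.unique h2)
  obtain ⟨u, hu⟩ := Finite.surjective_of_injective hf ⟨w, hle, hw⟩
  exact ⟨u.1, ℓ u, hℓ u, congrArg Subtype.val hu⟩

theorem Produces.landingLetter_eq {b n : ℕ} [NeZero n] (hb : 1 ≤ b) {w u : ZMod n → ℕ}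
    (hle : ∀ i, w i ≤ b) (hw : ∃ i, w i = b) (h : Produces w u) : landingLetter u = w := by
  obtain ⟨u', ℓ, h1, h2⟩ := exists_landingLetter_eq_word hb hle hw
  have h3 := h1.produces
  rw [h2] at h3
  rw [h.unique h3, h2]

/-! ### A criterion for primality -/

/-- The positions with a letter `b` or `b - 1` have different distances to the next letter `b`
(strictly to the right, cyclically). For letters at most `b`, as they occur here, `b ≤ w j + 1`
says that `w j` is one of the two. -/
def IsSeparated {n : ℕ} (b : ℕ) (w : ZMod n → ℕ) : Prop :=
  ∀ (j j' : ZMod n) (d : ℕ), 1 ≤ d → b ≤ w j + 1 → b ≤ w j' + 1 →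
    w (j + d) = b → w (j' + d) = b → (∀ e : ℕ, 1 ≤ e → e < d → w (j + e) ≠ b) →
    (∀ e : ℕ, 1 ≤ e → e < d → w (j' + e) ≠ b) → j = j'

namespace IsTrace

variable {b n : ℕ} [NeZero n] {u : ZMod n → ℕ} {ℓ : ZMod n → List ℕ} (h : IsTrace b u ℓ)
include h

theorem lt_landingLetter {i : ZMod n} {c d : ℕ} (hd : (ℓ i)[c]? = some d) :
    c < landingLetter u (i + d) := by
  obtain ⟨h1, h2, h3⟩ := h.of_getElem?_eq hd
  rw [← h3]
  exact h.count_lt_landingLetter h1 h2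

/-- A ball thrown with `C_b` lands after all balls that are in the air. Hence no such ball lands
before the last landing `d` of a state, except for those that are in the air already. -/
theorem landingLetter_ne {i : ZMod n} {d d' : ℕ} (hd : (ℓ i)[b - 1]? = some d) (hlt : d' < d)
    (hd' : d' ∉ ℓ i) : landingLetter u (i + d') ≠ b := by
  intro hw
  have hb : b - 1 < b := by
    have := (List.getElem?_eq_some_iff.1 hd).1
    rwa [h.length] at this
  have hu : u (i + d') ≠ 0 := by
    rw [← h.landingLetter_eq_zero.ne]; omega
  by_cases hS : d' ≤ flight u (i + d')
  · refine hd' ?_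
    have := List.mem_of_getElem? (h.getElem?_state hu hS)
    rwa [add_sub_cancel_right] at this
  · have h1 := h.getElem?_state hu le_rfl
    have h2 := h.count_flight hu
    rw [landingLetter, if_neg hu] at hw
    set S := flight u (i + d') with hSdef
    -- after the throw at `i + d' - S - 1` the last landing is `S` beats away, but the ball landing
    -- at `i + d` is still in the air
    obtain ⟨h3, h4, -⟩ := h.of_getElem?_eq hd
    have h5 := h.getElem?_state h3 (s := d - (d' - S)) (by omega)
    have h6 : i + (d : ZMod n) - ((d - (d' - S) : ℕ) : ZMod n) = i + d' - S := by
      rw [Nat.cast_sub (by omega), Nat.cast_sub (by omega)]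
      ring
    rw [h6] at h5
    have h7 := index_lt (h.pairwise _) h1 h5 (by omega)
    have h8 := (List.getElem?_eq_some_iff.1 h5).1
    rw [h.length] at h8
    omega

/-- The difference of the two last landings of a state is the distance from a letter `b` or
`b - 1` to the next `b`. For `b = 1` the beat before the state takes the role of the missing
landing. -/
theorem injective_of_isSeparated (hb : 1 ≤ b) (hw : IsSeparated b (landingLetter u)) :
    Function.Injective ℓ := by
  intro i i' hii
  have htop : b - 1 < (ℓ i).length := by rw [h.length]; omega
  obtain ⟨d, hd⟩ : ∃ d, (ℓ i)[b - 1]? = some d := ⟨_, List.getElem?_eq_getElem htop⟩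
  have hend : ∀ i, (ℓ i)[b - 1]? = some d → landingLetter u (i + d) = b := by
    intro i hi
    have h1 := h.lt_landingLetter hi
    have h2 := h.landingLetter_le (j := i + d)
    omega
  have hd' : (ℓ i')[b - 1]? = some d := hii ▸ hd
  rcases hb.eq_or_lt with rfl | hb2
  · have hgap : ∀ i, (ℓ i)[0]? = some d → ∀ e : ℕ, 1 ≤ e → e < d + 1 →
        landingLetter u (i - 1 + e) ≠ 1 := by
      intro i hi e he1 he2
      have h1 := h.landingLetter_ne hi (d' := e - 1) (by omega) fun hmem => by
        obtain ⟨c, hc⟩ := List.mem_iff_getElem?.1 hmem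
        have := index_lt (h.pairwise _) hc hi (by omega)
        omega
      rw [Nat.cast_sub he1] at h1
      convert h1 using 2
      push_cast
      ring_nf
    have h1 := hw (i - 1) (i' - 1) (d + 1) (by omega) (by omega) (by omega)
      (by refine (congrArg _ ?_).trans (hend i hd); push_cast; ring)
      (by refine (congrArg _ ?_).trans (hend i' hd'); push_cast; ring)
      (hgap i hd) (hgap i' hd')
    simpa using h1
  · have hsnd : b - 2 < (ℓ i).length := by rw [h.length]; omega
    obtain ⟨e₀, he₀⟩ : ∃ d, (ℓ i)[b - 2]? = some d := ⟨_, List.getElem?_eq_getElem hsnd⟩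
    have he₀' : (ℓ i')[b - 2]? = some e₀ := hii ▸ he₀
    have hlt := entry_lt (h.pairwise i) he₀ hd (by omega)
    have hgap : ∀ i, (ℓ i)[b - 1]? = some d → (ℓ i)[b - 2]? = some e₀ → ∀ e : ℕ, 1 ≤ e →
        e < d - e₀ → landingLetter u (i + e₀ + e) ≠ b := by
      intro i hi hi' e he1 he2
      have h1 := h.landingLetter_ne hi (d' := e₀ + e) (by omega) fun hmem => by
        obtain ⟨c, hc⟩ := List.mem_iff_getElem?.1 hmem
        have := index_lt (h.pairwise _) hc hi (by omega)
        have := index_lt (h.pairwise _) hi' hc (by omega)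
        omega
      rwa [Nat.cast_add, ← add_assoc] at h1
    have hsum : ∀ i : ZMod n, i + e₀ + ((d - e₀ : ℕ) : ZMod n) = i + d := by
      intro i
      rw [Nat.cast_sub hlt.le]
      ring
    have h1 := h.lt_landingLetter he₀
    have h2 := h.lt_landingLetter he₀'
    have h3 := hw (i + e₀) (i' + e₀) (d - e₀) (by omega) (by omega) (by omega)
      (by rw [hsum, hend i hd]) (by rw [hsum, hend i' hd'])
      (hgap i hd he₀) (hgap i' hd' he₀')
    simpa using h3

end IsTrace

/-! ### Cyclic words and blocks -/

/-- A nonempty word whose only letter `b` is the first one. -/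
def IsBlock (b : ℕ) (x : List ℕ) : Prop := ∃ y, x = b :: y ∧ b ∉ y

theorem exists_flatten_eq {b : ℕ} {Q : List (List ℕ)} (hQ : ∀ x ∈ Q, IsBlock b x)
    {X Y : List ℕ} (h : Q.flatten = X ++ b :: Y) :
    ∃ A B, Q = A ++ B ∧ A.flatten = X ∧ B.flatten = b :: Y := by
  induction Q generalizing X with
  | nil => simp at h
  | cons q Q ih =>
    obtain ⟨y, rfl, hy⟩ := hQ q (by simp)
    cases X with
    | nil => exact ⟨[], _, rfl, rfl, h⟩
    | cons x X =>
      simp only [List.flatten_cons, List.cons_append, List.cons.injEq] at h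
      obtain ⟨rfl, h⟩ := h
      rcases List.append_eq_append_iff.1 h with ⟨Z, h1, h2⟩ | ⟨Z, h1, h2⟩
      · obtain ⟨A, B, rfl, h3, h4⟩ := ih (fun x hx => hQ x (by simp [hx])) h2
        exact ⟨(b :: y) :: A, B, rfl, by simp [h3, h1], h4⟩
      · cases Z with
        | nil =>
          refine ⟨[b :: y], Q, rfl, by simpa using h1, by simpa using h2.symm⟩
        | cons z Z =>
          simp only [List.cons_append, List.cons.injEq] at h2
          exact absurd (by simp [h1, ← h2.1]) hy

theorem takeWhile_block {b : ℕ} {y : List ℕ} (hy : b ∉ y) {Q : List (List ℕ)}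
    (hQ : ∀ x ∈ Q, IsBlock b x) : (y ++ Q.flatten).takeWhile (· ≠ b) = y := by
  induction y with
  | nil =>
    cases Q with
    | nil => simp
    | cons q Q =>
      obtain ⟨y, rfl, -⟩ := hQ q (by simp)
      simp
  | cons a y ih =>
    simp only [List.mem_cons, not_or] at hy
    simp only [List.cons_append]
    rw [List.takeWhile_cons_of_pos (by simpa using Ne.symm hy.1), ih hy.2]

/-- A word is cut into blocks in at most one way. -/
theorem flatten_injective {b : ℕ} {Q Q' : List (List ℕ)} (hQ : ∀ x ∈ Q, IsBlock b x)
    (hQ' : ∀ x ∈ Q', IsBlock b x) (h : Q.flatten = Q'.flatten) : Q = Q' := by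
  induction Q generalizing Q' with
  | nil =>
    cases Q' with
    | nil => rfl
    | cons q Q' =>
      obtain ⟨y, rfl, -⟩ := hQ' q (by simp)
      simp at h
  | cons q Q ih =>
    obtain ⟨y, rfl, hy⟩ := hQ q (by simp)
    have hQ2 : ∀ x ∈ Q, IsBlock b x := fun x hx => hQ x (by simp [hx])
    cases Q' with
    | nil => simp at h
    | cons q' Q' =>
      obtain ⟨y', rfl, hy'⟩ := hQ' q' (by simp)
      have hQ2' : ∀ x ∈ Q', IsBlock b x := fun x hx => hQ' x (by simp [hx])
      simp only [List.flatten_cons, List.cons_append, List.cons.injEq, true_and] at h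
      have h1 := takeWhile_block hy hQ2
      rw [h, takeWhile_block hy' hQ2'] at h1
      subst h1
      rw [ih hQ2 hQ2' (List.append_cancel_left h)]

theorem isRotated_of_rotate_flatten {b k : ℕ} {Q Q' : List (List ℕ)}
    (hQ : ∀ x ∈ Q, IsBlock b x) (hQ' : ∀ x ∈ Q', IsBlock b x) (hk : k < Q.flatten.length)
    (h : Q'.flatten = Q.flatten.rotate k) : Q.IsRotated Q' := by
  rw [List.rotate_eq_drop_append_take hk.le] at h
  obtain ⟨Y, hY⟩ : ∃ Y, Q.flatten.drop k = b :: Y := by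
    rw [List.drop_eq_getElem_cons hk] at h ⊢
    cases Q' with
    | nil => simp only [List.flatten_nil, List.cons_append, reduceCtorEq] at h
    | cons q' Q' =>
      obtain ⟨y, rfl, -⟩ := hQ' q' (by simp)
      simp only [List.flatten_cons, List.cons_append, List.cons.injEq] at h
      exact ⟨_, by rw [← h.1]⟩
  obtain ⟨A, B, rfl, h1, h2⟩ := exists_flatten_eq hQ
    ((List.take_append_drop k Q.flatten).symm.trans (by rw [hY]))
  have h3 : Q' = B ++ A := by
    refine flatten_injective hQ' (fun x hx => hQ x ?_) ?_
    · simpa [or_comm] using hx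
    · exact h.trans (by rw [hY, ← h1, ← h2, List.flatten_append])
  rw [h3]
  exact List.isRotated_append

theorem isRotated_flatten {α : Type*} {Q Q' : List (List α)} (h : Q.IsRotated Q') :
    Q.flatten.IsRotated Q'.flatten := by
  obtain ⟨k, hk, rfl⟩ := List.isRotated_iff_mod.1 h
  rw [List.rotate_eq_drop_append_take hk, List.flatten_append]
  conv_lhs => rw [← List.take_append_drop k Q, List.flatten_append]
  exact List.isRotated_append

/-! ### Landing words of filled Ferrers diagrams -/

theorem landingList_append (A B : List (List ℕ)) :
    landingList (A ++ B) = landingList A ++ landingList B := by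
  simp [landingList]

theorem landingList_cons (r : List ℕ) (B : List (List ℕ)) :
    landingList (r :: B) = r.reverse ++ landingList B := by
  simp [landingList]

theorem landingWord_natCast {n k : ℕ} (R : List (List ℕ)) (hk : k < n) :
    landingWord n R (k : ZMod n) = (landingList R).getD k 0 := by
  rw [landingWord, ZMod.val_natCast_of_lt hk]

theorem landingWord_rotate {n : ℕ} [NeZero n] {R R' : List (List ℕ)} {k : ℕ}
    (hR : (landingList R).length = n)
    (h : landingList R' = (landingList R).rotate k) (j : ZMod n) :
    landingWord n R' j = landingWord n R (j + k) := by
  have hj := ZMod.val_lt j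
  have h1 : (j + (k : ZMod n)).val = (j.val + k) % n := by
    rw [ZMod.val_add, ZMod.val_natCast, Nat.add_mod_mod]
  have h2 : (j.val + k) % n < n := Nat.mod_lt _ (NeZero.pos n)
  rw [landingWord, landingWord, h1, h, List.getD_eq_getElem _ _ (by simpa [hR] using hj),
    List.getElem_rotate, List.getD_eq_getElem _ _ (by omega)]
  simp only [hR]

theorem landingList_eq_rotate {n : ℕ} [NeZero n] {R R' : List (List ℕ)} {k : ZMod n}
    (hR : (landingList R).length = n) (hR' : (landingList R').length = n)
    (h : ∀ j, landingWord n R' j = landingWord n R (j + k)) :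
    landingList R' = (landingList R).rotate k.val := by
  refine List.ext_getElem (by simp [hR, hR']) fun i hi hi' => ?_
  have h1 := h (i : ZMod n)
  rw [landingWord_natCast _ (by omega), landingWord, ZMod.val_add,
    ZMod.val_natCast_of_lt (by omega), List.getD_eq_getElem _ _ hi,
    List.getD_eq_getElem _ _ (by rw [hR]; exact Nat.mod_lt _ (NeZero.pos n))] at h1
  rw [h1, List.getElem_rotate]
  simp only [hR]

theorem exists_row_of_lt_length {R : List (List ℕ)} {k : ℕ} (hk : k < (landingList R).length) :
    ∃ A r B s, R = A ++ r :: B ∧ s < r.length ∧ k = (landingList A).length + s := by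
  induction R generalizing k with
  | nil => simp [landingList] at hk
  | cons q R ih =>
    by_cases hq : k < q.length
    · exact ⟨[], q, R, k, rfl, hq, by simp [landingList]⟩
    · rw [landingList_cons, List.length_append, List.length_reverse] at hk
      obtain ⟨A, r, B, s, h1, h2, h3⟩ := ih (k := k - q.length) (by omega)
      refine ⟨q :: A, r, B, s, by rw [h1]; rfl, h2, ?_⟩
      rw [landingList_cons, List.length_append, List.length_reverse]
      omega

namespace IsFilledDiagram

variable {b n : ℕ} {D : List (List ℕ)} (hD : IsFilledDiagram b n D)
include hD

theorem isBlock {r : List ℕ} (hr : r ∈ D) : IsBlock b r.reverse := by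
  have h1 := hD.rightmost r hr
  have h2 := hD.not_rightmost r hr
  obtain ⟨x, rfl⟩ : ∃ x, r = x ++ [b] := ⟨_, (List.dropLast_append_getLast? b h1).symm⟩
  exact ⟨x.reverse, by simp, by simpa using h2⟩

theorem nodup : D.Nodup :=
  List.Nodup.of_map List.length (hD.strictly_decreasing.imp fun h => (ne_of_lt h).symm)

variable {R : List (List ℕ)} (hR : R.Perm D)
include hR

theorem length_landingList : (landingList R).length = n := by
  rw [landingList, List.length_flatten, List.map_map, ← hD.size, ← (hR.map List.length).sum_eq]
  congr 2
  funext r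
  simp

theorem landingWord_le (j : ZMod n) : landingWord n R j ≤ b := by
  rw [landingWord, List.getD_eq_getElem?_getD]
  rcases h : (landingList R)[j.val]? with _ | v
  · simp
  · have := List.mem_of_getElem? h
    rw [landingList, List.mem_flatten] at this
    obtain ⟨x, hx, hv⟩ := this
    obtain ⟨r, hr, rfl⟩ := List.mem_map.1 hx
    exact hD.entry_le r (hR.mem_iff.1 hr) v (List.mem_reverse.1 hv)

theorem landingWord_row {A B : List (List ℕ)} {r : List ℕ} (hRA : R = A ++ r :: B) {s : ℕ}
    (hs : s < r.length) :
    r.reverse[s]? = some (landingWord n R (((landingList A).length + s : ℕ) : ZMod n)) := by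
  have hlen := hD.length_landingList hR
  subst hRA
  rw [landingList_append, landingList_cons] at hlen
  simp only [List.length_append, List.length_reverse] at hlen
  rw [landingWord_natCast _ (by omega), landingList_append, landingList_cons]
  rw [List.getD_eq_getElem?_getD, List.getElem?_append_right (by omega), Nat.add_sub_cancel_left,
    List.getElem?_append_left (by simpa using hs)]
  rw [List.getElem?_eq_getElem (by simpa using hs), Option.getD_some]

theorem landingWord_start {A B : List (List ℕ)} {r : List ℕ} (hRA : R = A ++ r :: B) :
    landingWord n R ((landingList A).length : ZMod n) = b := by
  have hr : r ∈ D := hR.mem_iff.1 (by simp [hRA])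
  obtain ⟨y, hy, -⟩ := hD.isBlock hr
  have h1 := hD.landingWord_row hR hRA (s := 0) (List.length_pos_of_ne_nil (hD.row_ne_nil r hr))
  rw [hy] at h1
  simpa using h1.symm

theorem landingWord_zero (hn : 1 ≤ n) : landingWord n R 0 = b := by
  cases R with
  | nil =>
    have := hD.length_landingList hR
    simp [landingList] at this
    omega
  | cons r B => simpa [landingList] using hD.landingWord_start hR (A := []) rfl

/-- The row read at a position is followed by a letter `b`, the start of the next row. -/
theorem landingWord_next (hn : 1 ≤ n) {A B : List (List ℕ)} {r : List ℕ}
    (hRA : R = A ++ r :: B) :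
    landingWord n R (((landingList A).length + r.length : ℕ) : ZMod n) = b := by
  cases B with
  | nil =>
    have hlen := hD.length_landingList hR
    have h0 := hD.landingWord_zero hR hn
    rw [hRA, landingList_append, landingList_cons] at hlen
    simp [landingList] at hlen
    rw [show (landingList A).length + r.length = n by simpa [landingList] using hlen]
    simpa using h0
  | cons r' B =>
    have h1 := hD.landingWord_start hR (A := A ++ [r]) (r := r') (B := B) (by simp [hRA])
    rwa [landingList_append, landingList_cons, List.length_append, List.length_append,
      List.length_reverse, show (landingList []).length = 0 from rfl, add_zero] at h1

/-- The distance from a position to the next `b` is the column of its cell. -/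
theorem exists_cell (hn : 1 ≤ n) {j : ZMod n} {d : ℕ} (hd : 1 ≤ d)
    (hend : landingWord n R (j + d) = b)
    (hgap : ∀ e : ℕ, 1 ≤ e → e < d → landingWord n R (j + e) ≠ b) :
    ∃ A r B, R = A ++ r :: B ∧ d ≤ r.length ∧
      j = (((landingList A).length + (r.length - d) : ℕ) : ZMod n) ∧
      r[d - 1]? = some (landingWord n R j) := by
  have : NeZero n := ⟨by omega⟩
  obtain ⟨A, r, B, s, h1, h2, h3⟩ := exists_row_of_lt_length (R := R) (k := j.val)
    (by rw [hD.length_landingList hR]; exact ZMod.val_lt j)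
  have hj : j = (((landingList A).length + s : ℕ) : ZMod n) := by
    rw [← h3, ZMod.natCast_zmod_val]
  have hjd : ∀ e : ℕ, j + e = (((landingList A).length + (s + e) : ℕ) : ZMod n) := by
    intro e
    rw [hj]
    push_cast
    ring
  have hr : r ∈ D := hR.mem_iff.1 (by simp [h1])
  have hds : d = r.length - s := by
    rcases lt_trichotomy d (r.length - s) with hlt | heq | hgt
    · exfalso
      have h4 := hD.landingWord_row hR h1 (s := s + d) (by omega)
      rw [← hjd, hend] at h4
      obtain ⟨y, hy, hby⟩ := hD.isBlock hr
      rw [hy, show s + d = s + d - 1 + 1 by omega, List.getElem?_cons_succ] at h4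
      exact hby (List.mem_of_getElem? h4)
    · exact heq
    · exfalso
      refine hgap (r.length - s) (by omega) hgt ?_
      rw [hjd, Nat.add_sub_cancel' h2.le]
      exact hD.landingWord_next hR hn h1
  have h4 := hD.landingWord_row hR h1 h2
  rw [← hj, List.getElem?_reverse h2, show r.length - 1 - s = d - 1 by omega] at h4
  refine ⟨A, r, B, h1, by omega, ?_, h4⟩
  rw [show r.length - d = s by omega]
  exact hj

theorem isSeparated (hn : 1 ≤ n) : IsSeparated b (landingWord n R) := by
  intro j j' d hd hj hj' hend hend' hgap hgap'
  obtain ⟨A, r, B, h1, h2, h3, h4⟩ := hD.exists_cell hR hn hd hend hgap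
  obtain ⟨A', r', B', h1', h2', h3', h4'⟩ := hD.exists_cell hR hn hd hend' hgap'
  have hle := hD.landingWord_le hR j
  have hle' := hD.landingWord_le hR j'
  have hrr : r = r' := by
    refine hD.column (d - 1) r (hR.mem_iff.1 (by simp [h1])) r' (hR.mem_iff.1 (by simp [h1']))
      ?_ ?_
    · rw [h4, Option.some_inj, Option.some_inj]; omega
    · rw [h4', Option.some_inj, Option.some_inj]; omega
  subst hrr
  have hnd : R.Nodup := hR.nodup_iff.2 hD.nodup
  have hAA : A = A' := by
    have h5 := hnd
    have h6 := hnd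
    rw [h1] at h5
    rw [h1'] at h6
    have h7 : r ∉ A := fun hmem =>
      (List.nodup_append.1 h5).2.2 r hmem r (by simp) rfl
    have h7' : r ∉ A' := fun hmem =>
      (List.nodup_append.1 h6).2.2 r hmem r (by simp) rfl
    have h8 := congrArg (List.idxOf r) (h1.symm.trans h1')
    rw [List.idxOf_append_of_notMem h7, List.idxOf_append_of_notMem h7'] at h8
    simp only [List.idxOf_cons_self, add_zero] at h8
    have h9 := congrArg (List.take A.length) (h1.symm.trans h1')
    rwa [List.take_left, h8, List.take_left] at h9
  rw [h3, h3', hAA]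

end IsFilledDiagram

/-- A diagram is determined by the set of its rows. -/
theorem IsFilledDiagram.eq_of_perm {b n : ℕ} {D D' : List (List ℕ)}
    (hD : IsFilledDiagram b n D) (hD' : IsFilledDiagram b n D') (h : D.Perm D') : D = D' := by
  have h1 := List.pairwise_map.1 hD.strictly_decreasing
  have h2 := List.pairwise_map.1 hD'.strictly_decreasing
  exact h.eq_of_pairwise (fun a b _ _ h h' => absurd h (lt_asymm h')) h1 h2

/-! ### Patterns obtained from diagrams -/

theorem landingLetter_shift {n : ℕ} (u : ZMod n → ℕ) (k j : ZMod n) :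
    landingLetter (fun i => u (i + k)) j = landingLetter u (j + k) := by
  have h1 : ∀ s, count (fun i => u (i + k)) j s = count u (j + k) s := by
    intro s
    induction s with
    | zero => rfl
    | succ s ih => rw [count_succ, count_succ, ih, sub_add_eq_add_sub]
  have h2 : flight (fun i => u (i + k)) j = flight u (j + k) := by
    simp only [flight, h1, sub_add_eq_add_sub]
  simp only [landingLetter, throwTime, h2, sub_add_eq_add_sub]

/-- A closed walk, started `k` beats later. -/
def ClosedWalk.shift {b n : ℕ} (W : ClosedWalk b n) (k : ZMod n) : ClosedWalk b n where
  state i := W.state (i + k)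
  card_state i := W.card_state _
  step i := by rw [add_right_comm]; exact W.step _

theorem ClosedWalk.cards_shift {b n : ℕ} (W : ClosedWalk b n) (k : ZMod n) :
    (W.shift k).cards = fun i => W.cards (i + k) := by
  funext i
  change throwCard (W.state (i + k)) (W.state (i + 1 + k)) = _
  rw [add_right_comm]
  rfl

theorem ClosedWalk.isRotation_iff {b n : ℕ} {W W' : ClosedWalk b n} :
    W.IsRotation W' ↔ ∃ k, W' = W.shift k := by
  constructor
  · rintro ⟨k, hk⟩
    exact ⟨k, ClosedWalk.ext (funext hk)⟩
  · rintro ⟨k, rfl⟩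
    exact ⟨k, fun i => rfl⟩

namespace IsFilledDiagram

variable {b n : ℕ} [NeZero n] {D R : List (List ℕ)}

theorem landingLetter_cards (hb : 1 ≤ b) (hD : IsFilledDiagram b n D) (hR : R.Perm D)
    {W : ClosedWalk b n} (h : Produces (landingWord n R) W.cards) :
    landingLetter W.cards = landingWord n R :=
  h.landingLetter_eq hb (hD.landingWord_le hR) ⟨0, hD.landingWord_zero hR (NeZero.one_le)⟩

theorem isPrime (hb : 1 ≤ b) (hD : IsFilledDiagram b n D) (hR : R.Perm D)
    {W : ClosedWalk b n} (h : Produces (landingWord n R) W.cards) : W.IsPrime := by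
  have h1 := W.isTrace.injective_of_isSeparated hb
    (by rw [hD.landingLetter_cards hb hR h]; exact hD.isSeparated hR (NeZero.one_le))
  intro i i' hii
  exact h1 (by simp only [hii])

theorem exists_walk (hb : 1 ≤ b) (hD : IsFilledDiagram b n D) (hR : R.Perm D) :
    ∃ W : ClosedWalk b n, Produces (landingWord n R) W.cards := by
  obtain ⟨u, ℓ, h, hw⟩ := exists_landingLetter_eq_word hb (hD.landingWord_le hR)
    ⟨0, hD.landingWord_zero hR (NeZero.one_le)⟩
  refine ⟨h.walk, ?_⟩
  rw [h.cards_walk, ← hw]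
  exact h.produces

theorem isRotation_iff (hb : 1 ≤ b) {D' R' : List (List ℕ)} (hD : IsFilledDiagram b n D)
    (hR : R.Perm D) (hD' : IsFilledDiagram b n D') (hR' : R'.Perm D')
    {W W' : ClosedWalk b n} (h : Produces (landingWord n R) W.cards)
    (h' : Produces (landingWord n R') W'.cards) :
    W.IsRotation W' ↔ D = D' ∧ R.IsRotated R' := by
  have hw := hD.landingLetter_cards hb hR h
  have hw' := hD'.landingLetter_cards hb hR' h'
  have hlen := hD.length_landingList hR
  have hlen' := hD'.length_landingList hR'
  rw [ClosedWalk.isRotation_iff]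
  constructor
  · rintro ⟨k, rfl⟩
    have h1 : ∀ j, landingWord n R' j = landingWord n R (j + k) := by
      intro j
      rw [← hw', ← hw, W.cards_shift, landingLetter_shift]
    have h2 := landingList_eq_rotate hlen hlen' h1
    have hblock : ∀ {D R : List (List ℕ)}, IsFilledDiagram b n D → R.Perm D →
        ∀ x ∈ R.map List.reverse, IsBlock b x := by
      intro D R hD hR x hx
      obtain ⟨r, hr, rfl⟩ := List.mem_map.1 hx
      exact hD.isBlock (hR.mem_iff.1 hr)
    have h3 := isRotated_of_rotate_flatten (hblock hD hR) (hblock hD' hR')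
      (lt_of_lt_of_eq (ZMod.val_lt k) hlen.symm) h2
    have h4 : R.IsRotated R' := by
      simpa [List.map_map, Function.comp_def] using h3.map List.reverse
    exact ⟨hD.eq_of_perm hD' (hR.symm.trans (h4.perm.trans hR')), h4⟩
  · rintro ⟨-, h1⟩
    obtain ⟨k, hk⟩ := isRotated_flatten (h1.map List.reverse)
    have h2 := landingWord_rotate (R' := R') hlen hk.symm
    refine ⟨k, ClosedWalk.ext_cards hb (h'.unique ?_)⟩
    have h3 := (W.shift k).isTrace.produces
    convert h3 using 1
    funext j
    rw [h2, ← hw, W.cards_shift, landingLetter_shift]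

end IsFilledDiagram

theorem finite_closedWalk {b n : ℕ} [NeZero n] (hb : 1 ≤ b) : Finite (ClosedWalk b n) := by
  refine Finite.of_injective
    (fun W : ClosedWalk b n => fun i =>
      (⟨W.cards i, Nat.lt_succ_of_le (W.isTrace.card_le i)⟩ : Fin (b + 1))) fun W W' h => ?_
  refine ClosedWalk.ext_cards hb (funext fun i => ?_)
  exact congrArg Fin.val (congrFun h i)

theorem eq_of_isRotated_cons {α : Type*} {a : α} {l l' : List α} (hl : (a :: l).Nodup)
    (h : (a :: l).IsRotated (a :: l')) : l = l' := by
  obtain ⟨k, hk, h⟩ := List.isRotated_iff_mod.1 h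
  have h0 : 0 < ((a :: l).rotate k).length := by simp
  have h1 : ((a :: l).rotate k)[0] = a := by simp only [h, List.getElem_cons_zero]
  rw [List.getElem_rotate] at h1
  have h2 : (0 + k) % (a :: l).length = 0 :=
    (hl.getElem_inj_iff (hi := Nat.mod_lt _ (by simp)) (hj := by simp)).1 h1
  rw [zero_add] at h2
  rw [← List.rotate_mod, h2, List.rotate_zero] at h
  exact (List.cons.inj h).2

/-- Each cyclic order of the rows is represented by exactly one arrangement that begins with the
first row of the diagram. -/
theorem sum_factorial_le_primeCount {b n : ℕ} [NeZero n] (hb : 1 ≤ b)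
    {S : Finset (List (List ℕ))} (hS : ∀ D ∈ S, IsFilledDiagram b n D) :
    ∑ D ∈ S, (D.length - 1).factorial ≤ primeCount b n := by
  let X : Finset (Σ _ : List (List ℕ), List (List ℕ)) :=
    S.sigma fun D => D.tail.permutations.toFinset
  have hX : X.card = ∑ D ∈ S, (D.length - 1).factorial := by
    rw [Finset.card_sigma]
    refine Finset.sum_congr rfl fun D hD => ?_
    rw [List.toFinset_card_of_nodup (List.nodup_permutations _
      ((hS D hD).nodup.sublist (List.tail_sublist D))), List.length_permutations, List.length_tail]
  have hmem : ∀ x : X, IsFilledDiagram b n x.1.1 ∧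
      (x.1.1.headD [] :: x.1.2).Perm x.1.1 := by
    rintro ⟨⟨D, τ⟩, hx⟩
    obtain ⟨h1, h2⟩ := Finset.mem_sigma.1 hx
    have h2' := List.mem_permutations.1 (List.mem_toFinset.1 h2)
    have hD := hS D h1
    refine ⟨hD, ?_⟩
    cases D with
    | nil =>
      have := hD.size
      simp at this
      exact absurd this.symm (NeZero.ne n)
    | cons r D => exact h2'.cons r
  choose W hW using fun x : X => (hmem x).1.exists_walk hb (hmem x).2
  let f : X → Quotient (primeSetoid b n) := fun x =>
    Quotient.mk _ ⟨W x, (hmem x).1.isPrime hb (hmem x).2 (hW x)⟩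
  have hf : Function.Injective f := by
    intro x y hxy
    have h1 : (W x).IsRotation (W y) := Quotient.exact hxy
    obtain ⟨h2, h3⟩ := ((hmem x).1.isRotation_iff hb (hmem x).2 (hmem y).1 (hmem y).2
      (hW x) (hW y)).1 h1
    have h4 := (hmem x).2.nodup_iff.2 (hmem x).1.nodup
    rw [← h2] at h3
    exact Subtype.ext (Sigma.ext h2 (heq_of_eq (eq_of_isRotated_cons h4 h3)))
  have := finite_closedWalk (n := n) hb
  rw [← hX, primeCount, ← Fintype.card_coe, ← Nat.card_eq_fintype_card]
  exact Nat.card_le_card_of_injective f hf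

/-! ### Counting filled Ferrers diagrams -/

/-- Column `j` (counted from `0`) of a filling has at most one entry in `{b, b - 1}`, called its
marked entry. These are the rows that may hold it, with `none` for a column without marked entry.
If a row ends in the column, its last entry is the marked one. -/
def markers {t : ℕ} (p : Fin t → ℕ) (j : ℕ) : Finset (Option (Fin t)) :=
  if ∃ i, p i = j + 1 then Finset.univ.filter fun o => ∃ i, o = some i ∧ p i = j + 1
  else Finset.univ.filter fun o => ∀ i, o = some i → j < p i

/-- The possible entries of column `j` in row `i` if the marked entry is in row `o`: a cell at the
end of its row can only be filled with `b`, another marked cell with `b - 1`. Positions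
outside the diagram hold `0`. -/
def cellEntries (b : ℕ) {t : ℕ} (p : Fin t → ℕ) (j : ℕ) (o : Option (Fin t)) (i : Fin t) :
    Finset ℕ :=
  if j < p i then
    if o = some i then {if p i = j + 1 then b else b - 1} else Finset.range (b - 1)
  else {0}

/-- The possible fillings of column `j`. -/
def columns (b : ℕ) {t : ℕ} (p : Fin t → ℕ) (j : ℕ) : Finset (Fin t → ℕ) :=
  (markers p j).biUnion fun o => Fintype.piFinset (cellEntries b p j o)

/-- The diagram with row lengths `p` and columns `E`. -/
def diagramOfColumns {t n : ℕ} (p : Fin t → ℕ) (E : Fin n → Fin t → ℕ) : List (List ℕ) :=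
  List.ofFn fun i : Fin t => List.ofFn fun j : Fin (p i) =>
    if h : (j : ℕ) < n then E ⟨j, h⟩ i else 0

section

variable {b t n : ℕ} {p : Fin t → ℕ}

theorem part_le (hsum : ∑ i, p i = n) (i : Fin t) : p i ≤ n := by
  rw [← hsum]
  exact Finset.single_le_sum (fun _ _ => Nat.zero_le _) (Finset.mem_univ i)

theorem lt_of_some_mem_markers {j : ℕ} {i : Fin t} (h : some i ∈ markers p j) : j < p i := by
  unfold markers at h
  split_ifs at h with h1
  · obtain ⟨i', h2, h3⟩ := (Finset.mem_filter.1 h).2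
    cases h2
    omega
  · exact (Finset.mem_filter.1 h).2 i rfl

theorem cell_marked_iff (hb : 1 ≤ b) {j : ℕ} {o : Option (Fin t)} (ho : o ∈ markers p j)
    {c : Fin t → ℕ} (hc : c ∈ Fintype.piFinset (cellEntries b p j o)) (i : Fin t) :
    o = some i ↔ j < p i ∧ b ≤ c i + 1 := by
  have h1 := Fintype.mem_piFinset.1 hc i
  unfold cellEntries at h1
  constructor
  · rintro rfl
    have h2 := lt_of_some_mem_markers ho
    rw [if_pos h2, if_pos rfl, Finset.mem_singleton] at h1
    refine ⟨h2, ?_⟩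
    split_ifs at h1 <;> omega
  · rintro ⟨h2, h3⟩
    by_contra h4
    rw [if_pos h2, if_neg h4, Finset.mem_range] at h1
    omega

theorem pairwiseDisjoint_markers (hb : 1 ≤ b) (j : ℕ) :
    (markers p j : Set (Option (Fin t))).PairwiseDisjoint
      fun o => Fintype.piFinset (cellEntries b p j o) := by
  intro o ho o' ho' hne
  refine Finset.disjoint_left.2 fun c hc hc' => hne ?_
  ext i
  exact (cell_marked_iff hb ho hc i).trans (cell_marked_iff hb ho' hc' i).symm

/-- The rows that meet column `j` are the first ones. -/
theorem lt_iff_lt_card (hanti : ∀ i j : Fin t, i < j → p j < p i) (j : ℕ) (i : Fin t) :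
    j < p i ↔ (i : ℕ) < (Finset.univ.filter fun i => j < p i).card := by
  constructor
  · intro h
    have hsub : Finset.Iic i ⊆ Finset.univ.filter fun i => j < p i := by
      intro k hk
      rw [Finset.mem_filter]
      refine ⟨Finset.mem_univ _, ?_⟩
      rcases (Finset.mem_Iic.1 hk).eq_or_lt with rfl | hlt
      · exact h
      · exact h.trans (hanti _ _ hlt)
    have := Finset.card_le_card hsub
    rw [Fin.card_Iic] at this
    omega
  · intro h
    by_contra hj
    have hsub : (Finset.univ.filter fun i => j < p i) ⊆ Finset.Iio i := by
      intro k hk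
      rw [Finset.mem_Iio]
      have hk' := (Finset.mem_filter.1 hk).2
      by_contra hik
      rcases (not_lt.1 hik).eq_or_lt with rfl | hlt
      · exact hj hk'
      · have := hanti _ _ hlt
        omega
    have := Finset.card_le_card hsub
    rw [Fin.card_Iio] at this
    omega

theorem prod_telescope {q : ℝ} (hq : 0 < q) {h : ℕ} (ht : h ≤ t) :
    ∏ i : Fin t, (if (i : ℕ) < h then ((i : ℝ) + 1 + q) / ((i : ℝ) + q) else 1) =
      ((h : ℝ) + q) / q := by
  rw [Fin.prod_univ_eq_prod_range
    (fun i : ℕ => if i < h then ((i : ℝ) + 1 + q) / ((i : ℝ) + q) else 1) t]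
  obtain ⟨m, rfl⟩ := Nat.exists_eq_add_of_le ht
  rw [Finset.prod_range_add, Finset.prod_eq_one (s := Finset.range m) (by simp), mul_one,
    Finset.prod_congr rfl fun i hi => if_pos (Finset.mem_range.1 hi)]
  clear ht
  induction h with
  | zero => simp [hq.ne']
  | succ h ih =>
    have : (h : ℝ) + q ≠ 0 := by positivity
    rw [Finset.prod_range_succ, ih]
    push_cast
    field_simp

theorem card_piFinset_cellEntries {q : ℝ} (hq : 0 < q) (hqb : ((b - 1 : ℕ) : ℝ) = q) {j : ℕ}
    {o : Option (Fin t)} (ho : o ∈ markers p j) :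
    ((Fintype.piFinset (cellEntries b p j o)).card : ℝ) =
      (∏ i, if j < p i then q else 1) * if o = none then 1 else 1 / q := by
  rw [Fintype.card_piFinset, Nat.cast_prod]
  cases o with
  | none =>
    rw [if_pos rfl, mul_one]
    refine Finset.prod_congr rfl fun i _ => ?_
    by_cases hj : j < p i <;> simp [cellEntries, hj, hqb]
  | some i₀ =>
    rw [if_neg (by simp), mul_one_div, eq_div_iff hq.ne']
    have h1 : ∏ i : Fin t, (if i₀ = i then q else 1) = q := by
      rw [Finset.prod_ite_eq, if_pos (Finset.mem_univ _)]
    conv_lhs => rw [← h1]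
    rw [← Finset.prod_mul_distrib]
    refine Finset.prod_congr rfl fun i _ => ?_
    unfold cellEntries
    by_cases hi : i₀ = i
    · subst hi
      simp [lt_of_some_mem_markers ho]
    · by_cases hj : j < p i <;> simp [hi, hj, hqb]

/-- A column of height `h` in which no row ends has `q ^ h + h * q ^ (h - 1)` fillings, where
`q = b - 1`; a column in which a row ends has `q ^ (h - 1)`. -/
theorem card_columns {q : ℝ} (hq : 0 < q) (hqb : ((b - 1 : ℕ) : ℝ) = q)
    (hanti : ∀ i j : Fin t, i < j → p j < p i) (j : ℕ) :
    ((columns b p j).card : ℝ) * ∏ i : Fin t, (if p i = j + 1 then (i : ℝ) + 1 + q else 1) =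
      ∏ i : Fin t, if j < p i then q * (((i : ℝ) + 1 + q) / ((i : ℝ) + q)) else 1 := by
  have hb : 1 ≤ b := by
    by_contra h0
    obtain rfl : b = 0 := by omega
    simp at hqb
    exact hq.ne hqb
  set h := (Finset.univ.filter fun i => j < p i).card with hdef
  have hht : h ≤ t := (Finset.card_le_univ _).trans (by simp)
  have hr : ∏ i : Fin t, (if j < p i then q * (((i : ℝ) + 1 + q) / ((i : ℝ) + q)) else 1) =
      (∏ i, if j < p i then q else 1) * (((h : ℝ) + q) / q) := by
    rw [← prod_telescope hq hht, ← Finset.prod_mul_distrib]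
    refine Finset.prod_congr rfl fun i _ => ?_
    have := lt_iff_lt_card hanti j i
    rw [← hdef] at this
    by_cases h1 : j < p i
    · rw [if_pos h1, if_pos h1, if_pos (this.1 h1)]
    · rw [if_neg h1, if_neg h1, if_neg (fun h2 => h1 (this.2 h2)), one_mul]
  have hcard : ((columns b p j).card : ℝ) =
      (∏ i, if j < p i then q else 1) * ∑ o ∈ markers p j, if o = none then 1 else 1 / q := by
    rw [columns, Finset.card_biUnion (pairwiseDisjoint_markers hb j), Nat.cast_sum, Finset.mul_sum]
    exact Finset.sum_congr rfl fun o ho => card_piFinset_cellEntries hq hqb ho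
  rw [hr, hcard, mul_assoc]
  congr 1
  by_cases hpart : ∃ i, p i = j + 1
  · obtain ⟨i₁, hi₁⟩ := hpart
    have huniq : ∀ i, p i = j + 1 ↔ i₁ = i := by
      intro i
      constructor
      · intro hi
        exact StrictAnti.injective (fun i j hij => hanti i j hij) (hi₁.trans hi.symm)
      · rintro rfl; exact hi₁
    have hm : markers p j = {some i₁} := by
      rw [markers, if_pos ⟨i₁, hi₁⟩]
      ext o
      simp only [huniq, Finset.mem_filter, Finset.mem_univ, true_and, Finset.mem_singleton]
      exact ⟨fun ⟨i, h1, h2⟩ => h2 ▸ h1, fun h1 => ⟨i₁, h1, rfl⟩⟩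
    -- row `i₁` is the last one that meets column `j`
    have hh : h = i₁ + 1 := by
      have h1 := (lt_iff_lt_card hanti j i₁).1 (by omega)
      rw [← hdef] at h1
      by_contra hne
      have h2 := (lt_iff_lt_card hanti j ⟨i₁ + 1, by omega⟩).2 (by rw [← hdef]; simp; omega)
      have h3 := hanti i₁ ⟨i₁ + 1, by omega⟩ (by simp [Fin.lt_def])
      omega
    simp only [huniq, Finset.prod_ite_eq, Finset.mem_univ, if_true, hm, Finset.sum_singleton, hh]
    simp
    ring
  · have h1 : ∏ i : Fin t, (if p i = j + 1 then (i : ℝ) + 1 + q else 1) = 1 :=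
      Finset.prod_eq_one fun i _ => if_neg fun hi => hpart ⟨i, hi⟩
    rw [h1, mul_one, markers, if_neg hpart, Finset.sum_filter, Fintype.sum_option]
    simp only [reduceCtorEq, false_imp_iff, implies_true, if_true, Option.some.injEq, if_false]
    rw [← Finset.sum_filter]
    have h2 : (Finset.univ.filter fun i : Fin t => ∀ k, i = k → j < p k) =
        Finset.univ.filter fun i => j < p i := by
      ext i; simp
    rw [h2, Finset.sum_const, ← hdef, nsmul_eq_mul]
    field_simp
    ring

theorem card_diagrams {q : ℝ} (hq : 0 < q) (hqb : ((b - 1 : ℕ) : ℝ) = q)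
    (hp : p ∈ distinctPartitions t n) :
    ((Fintype.piFinset fun j : Fin n => columns b p j).card : ℝ) *
        ∏ i : Fin t, ((i : ℝ) + 1 + q) =
      q ^ n * ∏ i : Fin t, (((i : ℝ) + 1 + q) / ((i : ℝ) + q)) ^ p i := by
  obtain ⟨hsum, hanti, hpos⟩ := Finset.mem_filter.1 hp
  rw [Finset.Nat.mem_antidiagonalTuple] at hsum
  have hle := part_le hsum
  have h1 := Finset.prod_congr rfl fun (j : Fin n) (_ : j ∈ Finset.univ) =>
    card_columns (b := b) hq hqb hanti (j : ℕ)
  rw [Finset.prod_mul_distrib, Finset.prod_comm] at h1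
  have h2 : ∀ i : Fin t, ∏ j : Fin n, (if p i = (j : ℕ) + 1 then (i : ℝ) + 1 + q else 1) =
      (i : ℝ) + 1 + q := by
    intro i
    have hi := hpos i
    have hi' := hle i
    have h3 : ∀ j : Fin n, p i = (j : ℕ) + 1 ↔ (⟨p i - 1, by omega⟩ : Fin n) = j := by
      intro j
      rw [Fin.ext_iff]
      simp only
      omega
    simp only [h3, Finset.prod_ite_eq, Finset.mem_univ, if_true]
  rw [Finset.prod_congr rfl fun i _ => h2 i] at h1
  rw [Fintype.card_piFinset, Nat.cast_prod, h1, Finset.prod_comm, ← hsum,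
    ← Finset.prod_pow_eq_pow_sum, ← Finset.prod_mul_distrib, hsum]
  refine Finset.prod_congr rfl fun i _ => ?_
  rw [← mul_pow, Fin.prod_univ_eq_prod_range
    (fun j => if j < p i then q * (((i : ℝ) + 1 + q) / ((i : ℝ) + q)) else 1) n,
    ← Finset.prod_filter, Finset.prod_const]
  congr 1
  have h4 : (Finset.range n).filter (fun j => j < p i) = Finset.range (p i) := by
    ext j
    have := hle i
    simp only [Finset.mem_filter, Finset.mem_range]
    omega
  rw [h4, Finset.card_range]

theorem length_diagramOfColumns (E : Fin n → Fin t → ℕ) :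
    (diagramOfColumns p E).length = t := by simp [diagramOfColumns]

theorem map_length_diagramOfColumns (E : Fin n → Fin t → ℕ) :
    (diagramOfColumns p E).map List.length = List.ofFn p := by
  simp [diagramOfColumns, List.map_ofFn, Function.comp_def]

theorem isFilledDiagram_diagramOfColumns (hb : 1 ≤ b) (hp : p ∈ distinctPartitions t n)
    {E : Fin n → Fin t → ℕ} (hE : E ∈ Fintype.piFinset fun j : Fin n => columns b p j) :
    IsFilledDiagram b n (diagramOfColumns p E) := by
  obtain ⟨hsum, hanti, hpos⟩ := Finset.mem_filter.1 hp
  rw [Finset.Nat.mem_antidiagonalTuple] at hsum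
  have hle := part_le hsum
  have hinj : Function.Injective p :=
    StrictAnti.injective fun i j hij => hanti i j hij
  have hcol : ∀ j : Fin n, ∃ o ∈ markers p j, E j ∈ Fintype.piFinset (cellEntries b p j o) :=
    fun j => Finset.mem_biUnion.1 (Fintype.mem_piFinset.1 hE j)
  have hcell : ∀ (j : Fin n) (i : Fin t), (j : ℕ) < p i →
      E j i ≤ b ∧ (E j i = b ↔ p i = j + 1) := by
    intro j i hj
    obtain ⟨o, ho, hc⟩ := hcol j
    have h1 := Fintype.mem_piFinset.1 hc i
    unfold cellEntries at h1
    rw [if_pos hj] at h1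
    split_ifs at h1 with h2 h3
    · rw [Finset.mem_singleton] at h1
      exact ⟨h1.le, by simp [h1, h3]⟩
    · rw [Finset.mem_singleton] at h1
      exact ⟨by omega, by omega⟩
    · rw [Finset.mem_range] at h1
      refine ⟨by omega, by omega, fun h3 => ?_⟩
      rw [markers, if_pos ⟨i, h3⟩] at ho
      obtain ⟨i', rfl, hi'⟩ := (Finset.mem_filter.1 ho).2
      exact absurd (by rw [hinj (hi'.trans h3.symm)]) h2
  have hrow : ∀ r ∈ diagramOfColumns p E, ∃ i : Fin t, r.length = p i ∧
      r = List.ofFn (fun j : Fin (p i) => if h : (j : ℕ) < n then E ⟨j, h⟩ i else 0) ∧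
      ∀ (k v : ℕ), r[k]? = some v → ∃ h : k < n, k < p i ∧ E ⟨k, h⟩ i = v := by
    intro r hr
    obtain ⟨i, rfl⟩ := List.mem_ofFn.1 hr
    refine ⟨i, by simp, rfl, fun k v hk => ?_⟩
    rw [List.getElem?_ofFn] at hk
    by_cases h1 : k < p i
    · have h2 : k < n := h1.trans_le (hle i)
      exact ⟨h2, h1, by simpa [h1, h2] using hk⟩
    · simp [h1] at hk
  refine ⟨?_, ?_, ?_, ?_, ?_, ?_, ?_⟩
  · rw [map_length_diagramOfColumns, List.pairwise_ofFn]
    exact fun i j hij => hanti i j hij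
  · intro r hr hnil
    obtain ⟨i, h1, -⟩ := hrow r hr
    have := hpos i
    simp [hnil] at h1
    omega
  · rw [map_length_diagramOfColumns, List.sum_ofFn, hsum]
  · intro r hr v hv
    obtain ⟨i, -, -, h3⟩ := hrow r hr
    obtain ⟨k, hk⟩ := List.mem_iff_getElem?.1 hv
    obtain ⟨h4, h5, rfl⟩ := h3 k v hk
    exact (hcell ⟨k, h4⟩ i h5).1
  · intro r hr
    obtain ⟨i, h1, -, h3⟩ := hrow r hr
    have hi := hpos i
    have hlt : r.length - 1 < r.length := by omega
    rw [List.getLast?_eq_getElem?, List.getElem?_eq_getElem hlt, Option.some_inj]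
    obtain ⟨h4, h5, h6⟩ := h3 _ _ (List.getElem?_eq_getElem hlt)
    rw [← h6]
    exact (hcell ⟨_, h4⟩ i h5).2.2 (by simp only; omega)
  · intro r hr hmem
    obtain ⟨i, h1, -, h3⟩ := hrow r hr
    obtain ⟨k, hk⟩ := List.mem_iff_getElem?.1 hmem
    rw [List.getElem?_dropLast] at hk
    split_ifs at hk with hkl
    obtain ⟨h4, h5, h6⟩ := h3 _ _ hk
    have := (hcell ⟨k, h4⟩ i h5).2.1 h6
    simp only at this
    omega
  · intro k r hr r' hr' hk hk'
    obtain ⟨i, -, h2, h3⟩ := hrow r hr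
    obtain ⟨i', -, h2', h3'⟩ := hrow r' hr'
    have key : ∃ (h : k < n), k < p i ∧ b ≤ E ⟨k, h⟩ i + 1 := by
      rcases hk with hk | hk <;> obtain ⟨h4, h5, h6⟩ := h3 _ _ hk <;> exact ⟨h4, h5, by omega⟩
    have key' : ∃ (h : k < n), k < p i' ∧ b ≤ E ⟨k, h⟩ i' + 1 := by
      rcases hk' with hk | hk <;> obtain ⟨h4, h5, h6⟩ := h3' _ _ hk <;> exact ⟨h4, h5, by omega⟩
    obtain ⟨h4, h5⟩ := key
    obtain ⟨_, h5'⟩ := key'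
    obtain ⟨o, ho, hc⟩ := hcol ⟨k, h4⟩
    have h6 := (cell_marked_iff hb ho hc i).2 h5
    have h6' := (cell_marked_iff hb ho hc i').2 h5'
    obtain rfl : i = i' := Option.some_injective _ (h6.symm.trans h6')
    exact h2.trans h2'.symm

theorem diagramOfColumns_injOn :
    Set.InjOn (diagramOfColumns p)
      (↑(Fintype.piFinset fun j : Fin n => columns b p j) : Set (Fin n → Fin t → ℕ)) := by
  intro E hE E' hE' h
  have hout : ∀ {E : Fin n → Fin t → ℕ}, E ∈ Fintype.piFinset (fun j : Fin n => columns b p j) →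
      ∀ (j : Fin n) (i : Fin t), ¬ (j : ℕ) < p i → E j i = 0 := by
    intro E hE j i hj
    obtain ⟨o, -, hc⟩ := Finset.mem_biUnion.1 (Fintype.mem_piFinset.1 hE j)
    have h1 := Fintype.mem_piFinset.1 hc i
    rwa [cellEntries, if_neg hj, Finset.mem_singleton] at h1
  funext j i
  by_cases hj : (j : ℕ) < p i
  · have h1 := congrFun (List.ofFn_injective h) i
    have h2 := congrFun (List.ofFn_injective h1) ⟨j, hj⟩
    simpa using h2
  · rw [hout (Finset.mem_coe.1 hE) j i hj, hout (Finset.mem_coe.1 hE') j i hj]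

end

theorem prod_add_eq_choose {b t : ℕ} (hb : 1 ≤ b) (ht : 1 ≤ t) :
    ∏ i ∈ Finset.range t, (i + b) = b * (t + b - 1).choose b * (t - 1).factorial := by
  obtain ⟨c, rfl⟩ : ∃ c, b = c + 1 := ⟨b - 1, by omega⟩
  obtain ⟨s, rfl⟩ : ∃ s, t = s + 1 := ⟨t - 1, by omega⟩
  have h1 := Nat.factorial_mul_ascFactorial c (s + 1)
  have h2 := Nat.add_choose_mul_factorial_mul_factorial (c + 1) s
  rw [Nat.ascFactorial_eq_prod_range, show c + (s + 1) = c + 1 + s by ring, ← h2,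
    Nat.factorial_succ] at h1
  refine Nat.eq_of_mul_eq_mul_left (Nat.factorial_pos c) ?_
  rw [show s + 1 + (c + 1) - 1 = c + 1 + s by omega, Nat.add_sub_cancel,
    Finset.prod_congr rfl fun i _ => Nat.add_comm i (c + 1), h1, Nat.choose_symm_add]
  ring

/-- The left side is the number of pairs of a diagram and a cyclic order of its rows. -/
theorem sum_card_diagrams_le_primeCount {b n : ℕ} [NeZero n] (hb : 1 ≤ b) :
    ∑ t ∈ Finset.Icc 1 n, ∑ p ∈ distinctPartitions t n,
      (Fintype.piFinset fun j : Fin n => columns b p j).card * (t - 1).factorial ≤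
        primeCount b n := by
  classical
  let S : Finset (List (List ℕ)) := (Finset.Icc 1 n).biUnion fun t =>
    (distinctPartitions t n).biUnion fun p =>
      (Fintype.piFinset fun j : Fin n => columns b p j).image (diagramOfColumns p)
  have hS : ∀ D ∈ S, IsFilledDiagram b n D := by
    intro D hD
    obtain ⟨t, -, hD⟩ := Finset.mem_biUnion.1 hD
    obtain ⟨p, hp, hD⟩ := Finset.mem_biUnion.1 hD
    obtain ⟨E, hE, rfl⟩ := Finset.mem_image.1 hD
    exact isFilledDiagram_diagramOfColumns hb hp hE
  refine le_of_eq_of_le ?_ (sum_factorial_le_primeCount hb hS)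
  rw [Finset.sum_biUnion]
  · refine Finset.sum_congr rfl fun t _ => ?_
    rw [Finset.sum_biUnion]
    · refine Finset.sum_congr rfl fun p _ => ?_
      rw [Finset.sum_image diagramOfColumns_injOn]
      simp only [length_diagramOfColumns, Finset.sum_const, smul_eq_mul]
    · intro p _ p' _ hne
      refine Finset.disjoint_left.2 fun D hD hD' => hne ?_
      obtain ⟨E, -, rfl⟩ := Finset.mem_image.1 hD
      obtain ⟨E', -, h⟩ := Finset.mem_image.1 hD'
      have h1 := congrArg (List.map List.length) h
      rw [map_length_diagramOfColumns, map_length_diagramOfColumns] at h1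
      exact (List.ofFn_injective h1).symm
  · intro t _ t' _ hne
    refine Finset.disjoint_left.2 fun D hD hD' => hne ?_
    obtain ⟨p, -, hD⟩ := Finset.mem_biUnion.1 hD
    obtain ⟨E, -, rfl⟩ := Finset.mem_image.1 hD
    obtain ⟨p', -, hD'⟩ := Finset.mem_biUnion.1 hD'
    obtain ⟨E', -, h⟩ := Finset.mem_image.1 hD'
    have h1 := congrArg List.length h
    rw [length_diagramOfColumns, length_diagramOfColumns] at h1
    exact h1.symm

theorem lowerBound_term {b t n : ℕ} (hb : 2 ≤ b) (ht : 1 ≤ t) {p : Fin t → ℕ}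
    (hp : p ∈ distinctPartitions t n) :
    (1 / (b : ℝ)) * (((b : ℝ) - 1) ^ n / (Nat.choose (t + b - 1) b : ℝ) *
      ∏ i : Fin t, ((((i : ℕ) + 1 : ℝ) + b - 1) / (((i : ℕ) + 1 : ℝ) + b - 2)) ^ p i) =
    (((Fintype.piFinset fun j : Fin n => columns b p j).card * (t - 1).factorial : ℕ) : ℝ) := by
  have hqb : ((b - 1 : ℕ) : ℝ) = (b : ℝ) - 1 := by
    rw [Nat.cast_sub (by omega), Nat.cast_one]
  have hq : (0 : ℝ) < (b : ℝ) - 1 := by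
    rw [← hqb]
    exact_mod_cast (by omega : 0 < b - 1)
  have h1 := card_diagrams hq hqb hp
  have h2 : ∏ i : Fin t, ((i : ℝ) + 1 + ((b : ℝ) - 1)) =
      (b : ℝ) * ((t + b - 1).choose b : ℝ) * ((t - 1).factorial : ℝ) := by
    have h3 := congrArg (Nat.cast : ℕ → ℝ) (prod_add_eq_choose (b := b) (by omega) ht)
    push_cast at h3
    rw [← h3, ← Fin.prod_univ_eq_prod_range (fun i : ℕ => (i : ℝ) + b) t]
    exact Finset.prod_congr rfl fun i _ => by ring
  have h4 : ∏ i : Fin t, ((((i : ℕ) + 1 : ℝ) + b - 1) / (((i : ℕ) + 1 : ℝ) + b - 2)) ^ p i =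
      ∏ i : Fin t, (((i : ℝ) + 1 + ((b : ℝ) - 1)) / ((i : ℝ) + ((b : ℝ) - 1))) ^ p i :=
    Finset.prod_congr rfl fun i _ => by
      congr 2 <;> ring
  have hb0 : (b : ℝ) ≠ 0 := by positivity
  have hc0 : ((t + b - 1).choose b : ℝ) ≠ 0 := by
    exact_mod_cast (Nat.choose_pos (by omega)).ne'
  rw [h4, div_mul_eq_mul_div (((b : ℝ) - 1) ^ n), ← h1, h2]
  push_cast
  field_simp

end Juggling

theorem mainTheorem1 (b n : ℕ) (hb : 1 ≤ b) (hn : 1 ≤ n) :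
    -- validity: the algorithm turns every landing word into a prime `b`-ball pattern of period `n`
    (∀ D R : List (List ℕ), Juggling.IsFilledDiagram b n D → R.Perm D →
      ∃ u : ZMod n → ℕ, Juggling.Produces (Juggling.landingWord n R) u ∧ (∀ i, u i ≤ b) ∧
        ∃ W : Juggling.ClosedWalk b n, W.IsPrime ∧ W.cards = u ∧
          ∀ W' : Juggling.ClosedWalk b n, W'.cards = u → W' = W) ∧
    -- distinctness: different diagrams or different cyclic orders of the rows give different
    -- patterns
    (∀ D R D' R' : List (List ℕ), Juggling.IsFilledDiagram b n D → R.Perm D →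
      Juggling.IsFilledDiagram b n D' → R'.Perm D' →
      ∀ W W' : Juggling.ClosedWalk b n,
        Juggling.Produces (Juggling.landingWord n R) W.cards →
        Juggling.Produces (Juggling.landingWord n R') W'.cards →
        (W.IsRotation W' ↔ D = D' ∧ R.IsRotated R')) ∧
    -- the lower bound; only `t ≤ n` contribute
    (2 ≤ b →
      (1 / (b : ℝ)) * ∑ t ∈ Finset.Icc 1 n, ∑ p ∈ Juggling.distinctPartitions t n,
          ((b : ℝ) - 1) ^ n / (Nat.choose (t + b - 1) b : ℝ) *
            ∏ i : Fin t,
              ((((i : ℕ) + 1 : ℝ) + b - 1) / (((i : ℕ) + 1 : ℝ) + b - 2)) ^ p i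
        ≤ (Juggling.primeCount b n : ℝ)) := by
  have : NeZero n := ⟨by omega⟩
  refine ⟨fun D R hD hR => ?_, fun D R D' R' hD hR hD' hR' W W' h h' =>
    hD.isRotation_iff hb hR hD' hR' h h', fun hb2 => ?_⟩
  · obtain ⟨W, hW⟩ := hD.exists_walk hb hR
    exact ⟨W.cards, hW, W.isTrace.card_le, W, hD.isPrime hb hR hW, rfl,
      fun W' h => Juggling.ClosedWalk.ext_cards hb h⟩
  · refine le_trans (le_of_eq ?_)
      (Nat.cast_le.2 (Juggling.sum_card_diagrams_le_primeCount (n := n) hb))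
    rw [Finset.mul_sum, Nat.cast_sum]
    refine Finset.sum_congr rfl fun t ht => ?_
    rw [Finset.mul_sum, Nat.cast_sum]
    exact Finset.sum_congr rfl fun p hp =>
      Juggling.lowerBound_term hb2 (Finset.mem_Icc.1 ht).1 hp
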